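/- Let $V$ be a ($D$-dimensional, Hausdorff) smooth manifold and let $\nabla$ be a smooth linear connection on $V$, extended to covariant tensor fields, with the convention that the first slot of $\nabla T$ is the slot of the derivative. Let $Y=(Y_p)_{p\in\mathbb N}$ be a sequence of Young diagrams such that $Y_p$ has $p$ cells for every $p$; for each $p$ choose a filling of the cells of $Y_p$ by the $p$ tensor slots, and let $\mathbf Y_p$ be the associated Young symmetrizer on covariant tensors of degree $p$ (symmetrize the slots in each row, then antisymmetrize the slots in each column, divided by the product of the hook lengths of $Y_p$). Let $\Omega^p_Y(V)$ be the $C^\infty(V)$-module of smooth covariant tensor fields of degree $p$ on $V$ whose value at every point lies in the image of $\mathbf Y_p$, let $\Omega_Y(V)=\bigoplus_{p}\Omega^p_Y(V)$, and let $d_\nabla$ be the operator of degree one on $\Omega_Y(V)$ given by $$d_\nabla=\mathbf Y_{p+1}\circ\nabla:\Omega^p_Y(V)\to\Omega^{p+1}_Y(V).$$ Let $N\ge 2$ be an integer and assume that, for every $p$, the number of columns of $Y_p$ is strictly smaller than $N$. Then $(d_\nabla)^N$ is a differential operator on $\Omega_Y(V)$ of order at most $N-1$. If, furthermore, $\nabla$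 is torsion-free, then $(d_\nabla)^N$ is a differential operator of order at most $N-2$. -/

import Mathlib

open scoped Manifold ContDiff Topology DirectSum

noncomputable section

namespace YoungCalculus

/-! ### Young symmetrizers acting on multilinear forms -/

section Young

variable {p : ℕ} {μ : YoungDiagram}

/-- A filling of the cells of a Young diagram `μ` by the `p` slots of a `p`-linear form,
each slot being used exactly once. Such a filling exists if and only if `μ` has `p` cells. -/
abbrev Filling (p : ℕ) (μ : YoungDiagram) : Type := Fin p ≃ {c : ℕ × ℕ // c ∈ μ.cells}

/-- The row of the slot `i`. -/
def Filling.row (t : Filling p μ) (i : Fin p) : ℕ := (t i).1.1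

/-- The column of the slot `i`. -/
def Filling.col (t : Filling p μ) (i : Fin p) : ℕ := (t i).1.2

/-- The permutations of the slots that preserve every row. -/
def Filling.rowPerms (t : Filling p μ) : Finset (Equiv.Perm (Fin p)) :=
  Finset.univ.filter fun σ => ∀ i, t.row (σ i) = t.row i

/-- The permutations of the slots that preserve every column. -/
def Filling.colPerms (t : Filling p μ) : Finset (Equiv.Perm (Fin p)) :=
  Finset.univ.filter fun σ => ∀ i, t.col (σ i) = t.col i

/-- The product of the hook lengths of `μ`: the hook of the cell `(i, j)` consists of the cell
itself, the cells to the right of it in row `i` and the cells below it in column `j`. -/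
def hookProduct (μ : YoungDiagram) : ℕ :=
  ∏ c ∈ μ.cells, ((μ.rowLen c.1 - (c.2 + 1)) + (μ.colLen c.2 - (c.1 + 1)) + 1)

variable {V : Type*} [AddCommGroup V] [Module ℝ V]

/-- The permutation `σ` of the slots: `(permute σ T) v = T (v ∘ σ)`. -/
def permute (σ : Equiv.Perm (Fin p)) :
    MultilinearMap ℝ (fun _ : Fin p => V) ℝ →ₗ[ℝ] MultilinearMap ℝ (fun _ : Fin p => V) ℝ :=
  (MultilinearMap.domDomCongrLinearEquiv ℝ ℝ V ℝ σ).toLinearMap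

theorem permute_apply (σ : Equiv.Perm (Fin p)) (T : MultilinearMap ℝ (fun _ : Fin p => V) ℝ)
    (v : Fin p → V) : permute σ T v = T fun i => v (σ i) := rfl

/-- The Young symmetrizer of a filled Young diagram acting on `p`-linear forms: symmetrize the
slots in each row, then antisymmetrize the slots in each column, and divide by the product of the
hook lengths (the normalization for which the Young symmetrizer is a projection; for one column of
`p` cells it is the antisymmetrizer). -/
def youngSymmetrizer (t : Filling p μ) :
    MultilinearMap ℝ (fun _ : Fin p => V) ℝ →ₗ[ℝ] MultilinearMap ℝ (fun _ : Fin p => V) ℝ :=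
  (hookProduct μ : ℝ)⁻¹ •
    ((∑ σ ∈ t.colPerms, ((Equiv.Perm.sign σ : ℤ) : ℝ) • permute σ) ∘ₗ
      (∑ τ ∈ t.rowPerms, permute τ))

end Young

/-! ### Smooth covariant tensor fields -/

section TensorFields

variable {D : ℕ} {M : Type*} [TopologicalSpace M] [ChartedSpace (EuclideanSpace ℝ (Fin D)) M]

/-- Not necessarily smooth covariant tensor fields of degree `p` on `M`: a `p`-linear form on
every tangent space. -/
def RawTensorField (D : ℕ) (M : Type*) [TopologicalSpace M]
    [ChartedSpace (EuclideanSpace ℝ (Fin D)) M] (p : ℕ) : Type _ :=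
  (x : M) → MultilinearMap ℝ (fun _ : Fin p => TangentSpace (𝓡 D) x) ℝ

namespace RawTensorField

variable {p : ℕ}

instance : AddCommGroup (RawTensorField D M p) :=
  inferInstanceAs (AddCommGroup
    ((x : M) → MultilinearMap ℝ (fun _ : Fin p => TangentSpace (𝓡 D) x) ℝ))

instance : Module ℝ (RawTensorField D M p) :=
  inferInstanceAs (Module ℝ
    ((x : M) → MultilinearMap ℝ (fun _ : Fin p => TangentSpace (𝓡 D) x) ℝ))

/-- Pointwise multiplication of tensor fields by smooth functions. -/
instance : Module C^∞⟮𝓡 D, M; ℝ⟯ (RawTensorField D M p) where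
  smul f T := fun x => f x • T x
  one_smul T := funext fun x => one_smul ℝ (T x)
  mul_smul f g T := funext fun x => mul_smul (f x) (g x) (T x)
  smul_zero f := funext fun x => smul_zero (f x)
  smul_add f S T := funext fun x => smul_add (f x) (S x) (T x)
  add_smul f g T := funext fun x => add_smul (f x) (g x) (T x)
  zero_smul T := funext fun x => zero_smul ℝ (T x)

theorem add_apply (S T : RawTensorField D M p) (x : M) : (S + T) x = S x + T x := rfl

theorem zero_apply (x : M) : (0 : RawTensorField D M p) x = 0 := rfl

theorem smul_apply (c : ℝ) (T : RawTensorField D M p) (x : M) : (c • T) x = c • T x := rfl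

theorem fsmul_apply (f : C^∞⟮𝓡 D, M; ℝ⟯) (T : RawTensorField D M p) (x : M) :
    (f • T) x = f x • T x := rfl

instance : IsScalarTower ℝ C^∞⟮𝓡 D, M; ℝ⟯ (RawTensorField D M p) where
  smul_assoc c f T := funext fun x => mul_smul c (f x) (T x)

end RawTensorField

variable [IsManifold (𝓡 D) ∞ M]

variable (D) in
/-- The coordinate frame around `x₀`: `frame D x₀ i x` is the value at `x` of the coordinate
vector field `∂ᵢ` of the preferred chart at `x₀` (zero outside of the domain of that chart). -/
def frame (x₀ : M) (i : Fin D) (x : M) : TangentSpace (𝓡 D) x :=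
  (trivializationAt (EuclideanSpace ℝ (Fin D)) (TangentSpace (𝓡 D) : M → Type _) x₀).localFrame
    (EuclideanSpace.basisFun (Fin D) ℝ).toBasis i x

/-- A tensor field is smooth if all its components in the charts of `M` are smooth. -/
def RawTensorField.IsSmooth {p : ℕ} (T : RawTensorField D M p) : Prop :=
  ∀ (x₀ : M) (j : Fin p → Fin D),
    ContMDiffOn (𝓡 D) 𝓘(ℝ, ℝ) ∞ (fun x => T x fun i => frame D x₀ (j i) x)
      (chartAt (EuclideanSpace ℝ (Fin D)) x₀).source

/-- The module of smooth covariant tensor fields of degree `p` over the smooth functions. -/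
def SmoothTensorField (D : ℕ) (M : Type*) [TopologicalSpace M]
    [ChartedSpace (EuclideanSpace ℝ (Fin D)) M] [IsManifold (𝓡 D) ∞ M] (p : ℕ) :
    Submodule C^∞⟮𝓡 D, M; ℝ⟯ (RawTensorField D M p) where
  carrier := {T | T.IsSmooth}
  add_mem' hS hT x₀ j := (hS x₀ j).add (hT x₀ j)
  zero_mem' _ _ := contMDiffOn_const
  smul_mem' f _ hT x₀ j := f.contMDiff.contMDiffOn.mul (hT x₀ j)


section evaluation

/-- The vector field `X` is differentiable at `x`. -/
abbrev DiffAt (X : (y : M) → TangentSpace (𝓡 D) y) (x : M) : Prop :=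
  MDifferentiableAt (𝓡 D) ((𝓡 D).prod 𝓘(ℝ, EuclideanSpace ℝ (Fin D)))
    (fun y => Bundle.TotalSpace.mk' (EuclideanSpace ℝ (Fin D)) y (X y)) x

/-- The vector field `X` is smooth at `x`. -/
abbrev SmoothAt (X : (y : M) → TangentSpace (𝓡 D) y) (x : M) : Prop :=
  ContMDiffAt (𝓡 D) ((𝓡 D).prod 𝓘(ℝ, EuclideanSpace ℝ (Fin D))) ∞
    (fun y => Bundle.TotalSpace.mk' (EuclideanSpace ℝ (Fin D)) y (X y)) x

variable {p : ℕ} {T : RawTensorField D M p}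

theorem mdifferentiableAt_frame (x : M) (i : Fin D) {y : M}
    (hy : y ∈ (chartAt (EuclideanSpace ℝ (Fin D)) x).source) :
    DiffAt (frame D x i) y :=
  (contMDiffAt_localFrame_of_mem 1 (trivializationAt (EuclideanSpace ℝ (Fin D))
    (TangentSpace (𝓡 D) : M → Type _) x) _ i hy).mdifferentiableAt (by simp)

theorem contMDiffAt_frame (x : M) (i : Fin D) {y : M}
    (hy : y ∈ (chartAt (EuclideanSpace ℝ (Fin D)) x).source) :
    SmoothAt (frame D x i) y :=
  contMDiffAt_localFrame_of_mem ∞ (trivializationAt (EuclideanSpace ℝ (Fin D))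
    (TangentSpace (𝓡 D) : M → Type _) x) _ i hy

theorem apply_expand (T : RawTensorField D M p) (X : Fin p → (x : M) → TangentSpace (𝓡 D) x)
    (x : M) :
    (fun y => T y fun i => X i y) =ᶠ[𝓝 x] fun y => ∑ j : Fin p → Fin D,
      (∏ i, (trivializationAt (EuclideanSpace ℝ (Fin D)) (TangentSpace (𝓡 D) : M → Type _)
        x).localFrameCoeff (𝓡 D) (EuclideanSpace.basisFun (Fin D) ℝ).toBasis (j i) y (X i y)) *
        T y fun i => frame D x (j i) y := by
  have h := fun i => Bundle.Trivialization.eventually_eq_localFrame_sum_coeff_smul (I := 𝓡 D)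
    (trivializationAt (EuclideanSpace ℝ (Fin D)) (TangentSpace (𝓡 D) : M → Type _) x)
    (EuclideanSpace.basisFun (Fin D) ℝ).toBasis (s := X i)
    (FiberBundle.mem_baseSet_trivializationAt' x)
  filter_upwards [Filter.eventually_all.2 h] with y hy
  have : (fun i => X i y) = fun i => ∑ k, _ := funext hy
  rw [this, MultilinearMap.map_sum]
  refine Finset.sum_congr rfl fun j _ => ?_
  rw [MultilinearMap.map_smul_univ]
  rfl

/-- A smooth tensor field evaluated on vector fields differentiable at `x` is differentiable
at `x`. -/
theorem mdifferentiableAt_apply (hT : T.IsSmooth) {X : Fin p → (x : M) → TangentSpace (𝓡 D) x}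
    {x : M} (hX : ∀ i, DiffAt (X i) x) :
    MDifferentiableAt (𝓡 D) 𝓘(ℝ, ℝ) (fun y => T y fun i => X i y) x := by
  refine MDifferentiableAt.congr_of_eventuallyEq ?_ (apply_expand T X x)
  rw [← Finset.sum_fn]
  refine MDifferentiableAt.sum (t := Finset.univ) fun j _ => MDifferentiableAt.mul ?_ ?_
  · rw [← Finset.prod_fn]
    refine MDifferentiableAt.prod (t := Finset.univ) fun i _ => ?_
    exact mdifferentiableAt_localFrameCoeff _ (FiberBundle.mem_baseSet_trivializationAt' x) (hX i) _
  · exact ((hT x j).contMDiffAt ((chartAt _ x).open_source.mem_nhds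
      (mem_chart_source _ x))).mdifferentiableAt (by simp)

/-- A smooth tensor field evaluated on vector fields that are smooth at `x` is smooth at `x`. -/
theorem contMDiffAt_apply (hT : T.IsSmooth) {X : Fin p → (x : M) → TangentSpace (𝓡 D) x}
    {x : M} (hX : ∀ i, SmoothAt (X i) x) :
    ContMDiffAt (𝓡 D) 𝓘(ℝ, ℝ) ∞ (fun y => T y fun i => X i y) x := by
  refine ContMDiffAt.congr_of_eventuallyEq ?_ (apply_expand T X x)
  refine contMDiffAt_finsetSum fun j _ => ContMDiffAt.mul ?_ ?_
  · refine contMDiffAt_finsetProd fun i _ => ?_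
    exact contMDiffAt_localFrameCoeff _ (FiberBundle.mem_baseSet_trivializationAt' x) (hX i) _
  · exact (hT x j).contMDiffAt ((chartAt _ x).open_source.mem_nhds (mem_chart_source _ x))

end evaluation

/-! ### The covariant derivative of a tensor field -/

section covariant

variable {p : ℕ} {T : RawTensorField D M p}
  (cov : CovariantDerivative (𝓡 D) (EuclideanSpace ℝ (Fin D)) (TangentSpace (𝓡 D) : M → Type _))

/-- For vector fields `X₁, …, Xₚ` and a tangent vector `v` at `x`, the number
`v (T (X₁, …, Xₚ)) - ∑ᵢ T (X₁, …, ∇ᵥ Xᵢ, …, Xₚ)`. -/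
def covAux (T : RawTensorField D M p) (x : M) (X : Fin p → (y : M) → TangentSpace (𝓡 D) y)
    (v : TangentSpace (𝓡 D) x) : ℝ :=
  mvfderiv (𝓡 D) (fun y => T y fun i => X i y) x v -
    ∑ i, T x (Function.update (fun k => X k x) i (cov (X i) x v))

theorem covAux_tensorial (hT : T.IsSmooth) {x : M} {X : Fin p → (y : M) → TangentSpace (𝓡 D) y}
    (hX : ∀ i, DiffAt (X i) x) (v : TangentSpace (𝓡 D) x) (i : Fin p) :
    TensorialAt (𝓡 D) (EuclideanSpace ℝ (Fin D))
      (fun σ => covAux cov T x (Function.update X i σ) v) x := by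
  have hev : ∀ (σ : (y : M) → TangentSpace (𝓡 D) y) (y : M),
      (fun k => Function.update X i σ k y) = Function.update (fun k => X k y) i (σ y) := by
    intro σ y
    funext k
    by_cases hk : k = i
    · subst hk; simp
    · simp [hk]
  have hd : ∀ σ : (y : M) → TangentSpace (𝓡 D) y, DiffAt σ x →
      MDifferentiableAt (𝓡 D) 𝓘(ℝ, ℝ)
        (fun y => T y (Function.update (fun k => X k y) i (σ y))) x := by
    intro σ hσ
    have := mdifferentiableAt_apply (x := x) hT (X := Function.update X i σ) (by
      intro k
      by_cases hk : k = i
      · subst hk; simpa using hσ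
      · simpa [hk] using hX k)
    simpa only [hev] using this
  have hsum : ∀ σ : (y : M) → TangentSpace (𝓡 D) y,
      ∑ k, T x (Function.update (Function.update (fun l => X l x) i (σ x)) k
        (cov (Function.update X i σ k) x v)) =
      T x (Function.update (fun l => X l x) i (cov σ x v)) +
      ∑ k ∈ Finset.univ.erase i, T x (Function.update (Function.update (fun l => X l x) k
        (cov (X k) x v)) i (σ x)) := by
    intro σ
    rw [← Finset.add_sum_erase _ _ (Finset.mem_univ i)]
    congr 1
    · simp
    · refine Finset.sum_congr rfl fun k hk => ?_
      have hki : k ≠ i := (Finset.mem_erase.1 hk).1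
      rw [Function.update_comm hki.symm, Function.update_of_ne hki]
  constructor
  · intro f σ hf hσ
    simp only [covAux, hev, hsum]
    have h1 : (fun y => T y (Function.update (fun k => X k y) i ((f • σ) y))) =
        fun y => f y * T y (Function.update (fun k => X k y) i (σ y)) := by
      funext y
      simp [MultilinearMap.map_update_smul]
    rw [h1, mvfderiv_fun_mul hf (hd σ hσ), cov.isCovariantDerivativeOn.leibniz hσ hf]
    simp [MultilinearMap.map_update_smul, MultilinearMap.map_update_add, Finset.mul_sum, mul_sub,
      mul_add]
    ring
  · intro σ σ' hσ hσ'
    simp only [covAux, hev, hsum]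
    have h1 : (fun y => T y (Function.update (fun k => X k y) i ((σ + σ') y))) =
        fun y => T y (Function.update (fun k => X k y) i (σ y)) +
          T y (Function.update (fun k => X k y) i (σ' y)) := by
      funext y
      simp [MultilinearMap.map_update_add]
    rw [h1, mvfderiv_fun_add (hd σ hσ) (hd σ' hσ'), cov.isCovariantDerivativeOn.add hσ hσ']
    simp [MultilinearMap.map_update_add, Finset.sum_add_distrib]
    ring

/-- `covAux` depends on the vector fields only through their values at `x`. -/
theorem covAux_congr (hT : T.IsSmooth) {x : M} {X Z : Fin p → (y : M) → TangentSpace (𝓡 D) y}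
    (hX : ∀ i, DiffAt (X i) x) (hZ : ∀ i, DiffAt (Z i) x)
    (h : ∀ i, X i x = Z i x) (v : TangentSpace (𝓡 D) x) :
    covAux cov T x X v = covAux cov T x Z v := by
  classical
  suffices ∀ s : Finset (Fin p), covAux cov T x X v = covAux cov T x (s.piecewise Z X) v by
    simpa using this Finset.univ
  intro s
  induction s using Finset.induction_on with
  | empty => simp
  | insert a s ha ih =>
    have hp : ∀ i, DiffAt (s.piecewise Z X i) x := by
      intro i
      by_cases hi : i ∈ s
      · simpa [hi] using hZ i
      · simpa [hi] using hX i
    rw [ih, Finset.piecewise_insert]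
    have := (covAux_tensorial cov hT hp v a).pointwise (hX a) (hZ a) (h a)
    rw [← this]
    congr 1
    conv_lhs => rw [← Function.update_eq_self a (s.piecewise Z X)]
    simp [ha]

theorem covAux_add (T : RawTensorField D M p) (x : M)
    (X : Fin p → (y : M) → TangentSpace (𝓡 D) y) (v w : TangentSpace (𝓡 D) x) :
    covAux cov T x X (v + w) = covAux cov T x X v + covAux cov T x X w := by
  simp only [covAux, map_add, MultilinearMap.map_update_add, Finset.sum_add_distrib]
  ring

theorem covAux_smul (T : RawTensorField D M p) (x : M)
    (X : Fin p → (y : M) → TangentSpace (𝓡 D) y) (c : ℝ) (v : TangentSpace (𝓡 D) x) :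
    covAux cov T x X (c • v) = c * covAux cov T x X v := by
  simp only [covAux, map_smul, MultilinearMap.map_update_smul, ← Finset.mul_sum, smul_eq_mul]
  ring

theorem extend_update (x : M) (v : Fin (p + 1) → TangentSpace (𝓡 D) x) (i : Fin p)
    (a : TangentSpace (𝓡 D) x) :
    (fun k : Fin p => FiberBundle.extend (EuclideanSpace ℝ (Fin D))
      (Function.update v i.succ a k.succ)) =
    Function.update (fun k : Fin p => FiberBundle.extend (EuclideanSpace ℝ (Fin D)) (v k.succ)) i
      (FiberBundle.extend (EuclideanSpace ℝ (Fin D)) a) := by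
  funext k
  by_cases hk : k = i
  · subst hk; simp
  · simp [hk]

theorem covAux_update_add (hT : T.IsSmooth) (x : M) (v : Fin (p + 1) → TangentSpace (𝓡 D) x)
    (i : Fin (p + 1)) (a b : TangentSpace (𝓡 D) x) :
    covAux cov T x (fun k => FiberBundle.extend (EuclideanSpace ℝ (Fin D))
        (Function.update v i (a + b) k.succ)) (Function.update v i (a + b) 0) =
      covAux cov T x (fun k => FiberBundle.extend (EuclideanSpace ℝ (Fin D))
        (Function.update v i a k.succ)) (Function.update v i a 0) +
      covAux cov T x (fun k => FiberBundle.extend (EuclideanSpace ℝ (Fin D))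
        (Function.update v i b k.succ)) (Function.update v i b 0) := by
  refine Fin.cases ?_ (fun i => ?_) i
  · simp [Fin.succ_ne_zero, covAux_add]
  · have h0 : ∀ c, Function.update v i.succ c 0 = v 0 := fun c =>
      Function.update_of_ne (Fin.succ_ne_zero i).symm _ _
    simp only [h0, extend_update]
    have ht := covAux_tensorial cov hT (x := x)
      (X := fun k => FiberBundle.extend (EuclideanSpace ℝ (Fin D)) (v k.succ))
      (fun _ => FiberBundle.mdifferentiableAt_extend ..) (v 0) i
    rw [← ht.add (FiberBundle.mdifferentiableAt_extend ..)
      (FiberBundle.mdifferentiableAt_extend ..)]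
    exact ht.pointwise (FiberBundle.mdifferentiableAt_extend ..)
      (mdifferentiableAt_add_section (FiberBundle.mdifferentiableAt_extend ..)
        (FiberBundle.mdifferentiableAt_extend ..)) (by simp)

theorem covAux_update_smul (hT : T.IsSmooth) (x : M) (v : Fin (p + 1) → TangentSpace (𝓡 D) x)
    (i : Fin (p + 1)) (c : ℝ) (a : TangentSpace (𝓡 D) x) :
    covAux cov T x (fun k => FiberBundle.extend (EuclideanSpace ℝ (Fin D))
        (Function.update v i (c • a) k.succ)) (Function.update v i (c • a) 0) =
      c • covAux cov T x (fun k => FiberBundle.extend (EuclideanSpace ℝ (Fin D))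
        (Function.update v i a k.succ)) (Function.update v i a 0) := by
  refine Fin.cases ?_ (fun i => ?_) i
  · simp [Fin.succ_ne_zero, covAux_smul]
  · have h0 : ∀ c, Function.update v i.succ c 0 = v 0 := fun c =>
      Function.update_of_ne (Fin.succ_ne_zero i).symm _ _
    simp only [h0, extend_update]
    have ht := covAux_tensorial cov hT (x := x)
      (X := fun k => FiberBundle.extend (EuclideanSpace ℝ (Fin D)) (v k.succ))
      (fun _ => FiberBundle.mdifferentiableAt_extend ..) (v 0) i
    rw [← ht.smul (f := fun _ => c) (mdifferentiable_const ..)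
      (FiberBundle.mdifferentiableAt_extend ..)]
    exact ht.pointwise (FiberBundle.mdifferentiableAt_extend ..)
      (mdifferentiableAt_const.smul_section (FiberBundle.mdifferentiableAt_extend ..)) (by simp)

/-- The covariant derivative of a smooth tensor field at a point: for tangent vectors
`v₀, …, vₚ` at `x` and vector fields `Xᵢ` extending `vᵢ`,
`(∇T)(v₀, …, vₚ) = v₀ (T (X₁, …, Xₚ)) - ∑ᵢ T (v₁, …, ∇_{v₀} Xᵢ, …, vₚ)`.
The slot of the derivative is the first one. -/
def covDerivAt (T : SmoothTensorField D M p) (x : M) :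
    MultilinearMap ℝ (fun _ : Fin (p + 1) => TangentSpace (𝓡 D) x) ℝ where
  toFun v := covAux cov T.1 x
    (fun i => FiberBundle.extend (EuclideanSpace ℝ (Fin D)) (v i.succ)) (v 0)
  map_update_add' := by
    intro inst v i a b
    rw [Subsingleton.elim inst (instDecidableEqFin (p + 1))]
    exact covAux_update_add cov T.2 x v i a b
  map_update_smul' := by
    intro inst v i c a
    rw [Subsingleton.elim inst (instDecidableEqFin (p + 1))]
    exact covAux_update_smul cov T.2 x v i c a

theorem covDerivAt_apply (T : SmoothTensorField D M p) (x : M)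
    (X : Fin p → (y : M) → TangentSpace (𝓡 D) y) (hX : ∀ i, DiffAt (X i) x)
    (v : Fin (p + 1) → TangentSpace (𝓡 D) x) (hv : ∀ i, X i x = v i.succ) :
    covDerivAt cov T x v = covAux cov T.1 x X (v 0) :=
  covAux_congr cov T.2 (fun _ => FiberBundle.mdifferentiableAt_extend ..) hX (by simp [hv]) _

theorem contMDiffAt_mvfderiv {g : M → ℝ} {X : (y : M) → TangentSpace (𝓡 D) y} {U : Set M}
    (hU : IsOpen U) (hg : ContMDiffOn (𝓡 D) 𝓘(ℝ, ℝ) ∞ g U) {x : M} (hx : x ∈ U)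
    (hX : SmoothAt X x) :
    ContMDiffAt (𝓡 D) 𝓘(ℝ, ℝ) ∞ (fun y => mvfderiv (𝓡 D) g y (X y)) x := by
  have h1 := hg.contMDiffOn_tangentMapWithin (m := ∞) (by simp) hU.uniqueMDiffOn
  have h2 : ContMDiffAt _ 𝓘(ℝ, ℝ).tangent ∞ (tangentMapWithin (𝓡 D) 𝓘(ℝ, ℝ) g U)
      (Bundle.TotalSpace.mk' (EuclideanSpace ℝ (Fin D)) x (X x) : TangentBundle (𝓡 D) M) :=
    h1.contMDiffAt ((hU.preimage (FiberBundle.continuous_proj _ _)).mem_nhds hx)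
  have h3 := (contMDiff_snd_tangentBundle_modelSpace ℝ 𝓘(ℝ, ℝ) (n := ∞)).contMDiffAt.comp x
    (h2.comp x hX)
  refine h3.congr_of_eventuallyEq ?_
  filter_upwards [hU.mem_nhds hx] with y hy
  simp only [Function.comp, tangentMapWithin]
  rw [mfderivWithin_of_isOpen hU hy]
  rfl

variable [T2Space M]

theorem smoothAt_cov [CovariantDerivative.ContMDiffCovariantDerivative cov ∞]
    {X Z : (y : M) → TangentSpace (𝓡 D) y} {x : M} (x₀ : M)
    (hx : x ∈ (chartAt (EuclideanSpace ℝ (Fin D)) x₀).source)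
    (hX : ∀ y ∈ (chartAt (EuclideanSpace ℝ (Fin D)) x₀).source, SmoothAt X y) (hZ : SmoothAt Z x) :
    SmoothAt (fun y => cov X y (Z y)) x := by
  set U := (chartAt (EuclideanSpace ℝ (Fin D)) x₀).source with hU
  have hUo : IsOpen U := (chartAt _ x₀).open_source
  obtain ⟨f, hf, hfU⟩ := ((SmoothBumpFunction.nhds_basis_tsupport (I := 𝓡 D) x).mem_iff.1
    (hUo.mem_nhds hx))
  have hs : ContMDiff (𝓡 D) ((𝓡 D).prod 𝓘(ℝ, EuclideanSpace ℝ (Fin D))) ∞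
      (fun y => Bundle.TotalSpace.mk' (EuclideanSpace ℝ (Fin D)) y
        (((f : M → ℝ) • X) y : TangentSpace (𝓡 D) y)) :=
    ContMDiffOn.smul_section_of_tsupport f.contMDiff.contMDiffOn hUo hfU
      fun y hy => (hX y hy).contMDiffWithinAt
  have hc := (CovariantDerivative.ContMDiffCovariantDerivative.contMDiff (cov := cov)
    (k := ∞)).contMDiff (σ := (f : M → ℝ) • X) hs.contMDiffOn
  have := (hc.contMDiffAt Filter.univ_mem).clm_bundle_apply hZ
  refine this.congr_of_eventuallyEq ?_
  filter_upwards [f.eventuallyEq_one.eventually_nhds, hUo.mem_nhds hx] with y hy hyU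
  have : cov ((f : M → ℝ) • X) y = cov X y := by
    refine cov.isCovariantDerivativeOnUniv.congr_of_eventuallyEq
      ((hs y).mdifferentiableAt (by simp)) ((hX y hyU).mdifferentiableAt (by simp))
      Filter.univ_mem ?_
    filter_upwards [hy] with z hz
    simp [hz]
  rw [this]

theorem covDerivAt_isSmooth [CovariantDerivative.ContMDiffCovariantDerivative cov ∞]
    (T : SmoothTensorField D M p) :
    RawTensorField.IsSmooth (D := D) (M := M) (p := p + 1) (covDerivAt cov T) := by
  intro x₀ j x hx
  have hUo : IsOpen (chartAt (EuclideanSpace ℝ (Fin D)) x₀).source := (chartAt _ x₀).open_source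
  apply ContMDiffAt.contMDiffWithinAt
  have heq : (fun y => covDerivAt cov T y fun i => frame D x₀ (j i) y) =ᶠ[𝓝 x]
      fun y => mvfderiv (𝓡 D) (fun z => T.1 z fun i => frame D x₀ (j i.succ) z) y
          (frame D x₀ (j 0) y) -
        ∑ i : Fin p, T.1 y fun k => Function.update (fun k => frame D x₀ (j k.succ)) i
          (fun y => cov (frame D x₀ (j i.succ)) y (frame D x₀ (j 0) y)) k y := by
    filter_upwards [hUo.mem_nhds hx] with y hy
    rw [covDerivAt_apply cov T y (fun i => frame D x₀ (j i.succ))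
      (fun i => mdifferentiableAt_frame _ _ hy) _ (fun _ => rfl), covAux]
    congr 1
    refine Finset.sum_congr rfl fun i _ => ?_
    congr 1
    funext k
    by_cases hk : k = i
    · subst hk; simp
    · simp [hk]
  refine ContMDiffAt.congr_of_eventuallyEq ?_ heq
  refine ContMDiffAt.sub (contMDiffAt_mvfderiv hUo (T.2 x₀ _) hx (contMDiffAt_frame _ _ hx)) ?_
  refine contMDiffAt_finsetSum fun i _ => contMDiffAt_apply T.2 fun k => ?_
  by_cases hk : k = i
  · subst hk
    simpa using smoothAt_cov cov x₀ hx (fun y hy => contMDiffAt_frame _ _ hy)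
      (contMDiffAt_frame _ _ hx)
  · simpa [hk] using contMDiffAt_frame _ _ hx

/-- The covariant derivative `∇` on smooth covariant tensor fields. -/
def nabla [CovariantDerivative.ContMDiffCovariantDerivative cov ∞] (p : ℕ) :
    SmoothTensorField D M p →ₗ[ℝ] SmoothTensorField D M (p + 1) where
  toFun T := ⟨covDerivAt cov T, covDerivAt_isSmooth cov T⟩
  map_add' S T := by
    refine Subtype.ext (funext fun x => MultilinearMap.ext fun v => ?_)
    change covAux cov (S.1 + T.1) x _ _ = covAux cov S.1 x _ _ + covAux cov T.1 x _ _
    simp only [covAux, RawTensorField.add_apply, _root_.add_apply]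
    rw [mvfderiv_fun_add
      (mdifferentiableAt_apply S.2 fun _ => FiberBundle.mdifferentiableAt_extend ..)
      (mdifferentiableAt_apply T.2 fun _ => FiberBundle.mdifferentiableAt_extend ..)]
    simp only [Finset.sum_add_distrib, _root_.add_apply]
    ring
  map_smul' c T := by
    refine Subtype.ext (funext fun x => MultilinearMap.ext fun v => ?_)
    change covAux cov (c • T.1) x _ _ = c • covAux cov T.1 x _ _
    simp only [covAux, RawTensorField.smul_apply, _root_.smul_apply]
    rw [mvfderiv_fun_smul mdifferentiableAt_const
      (mdifferentiableAt_apply T.2 fun _ => FiberBundle.mdifferentiableAt_extend ..)]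
    simp [mvfderiv_const, mul_sub, Finset.mul_sum]

/-- The defining property of `∇`: for vector fields `Xᵢ` differentiable at `x`,
`(∇T)(v, X₁, …, Xₚ) = v (T (X₁, …, Xₚ)) - ∑ᵢ T (X₁, …, ∇ᵥ Xᵢ, …, Xₚ)` at `x`. -/
theorem nabla_apply [CovariantDerivative.ContMDiffCovariantDerivative cov ∞]
    (T : SmoothTensorField D M p) (x : M) (X : Fin p → (y : M) → TangentSpace (𝓡 D) y)
    (hX : ∀ i, DiffAt (X i) x) (v : TangentSpace (𝓡 D) x) :
    (nabla cov p T).1 x (Fin.cons v fun i => X i x) =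
      mvfderiv (𝓡 D) (fun y => T.1 y fun i => X i y) x v -
        ∑ i, T.1 x (Function.update (fun k => X k x) i (cov (X i) x v)) :=
  covDerivAt_apply cov T x X hX _ fun _ => rfl

end covariant

/-! ### Tensor fields of given Young symmetry type and the operator `d_∇` -/

section calculus

variable {p : ℕ} {μ : YoungDiagram}

theorem permute_isSmooth {T : RawTensorField D M p} (hT : T.IsSmooth)
    (σ : Equiv.Perm (Fin p)) :
    RawTensorField.IsSmooth (D := D) (M := M) (p := p) (fun x => permute σ (T x)) :=
  fun x₀ j => hT x₀ fun i => j (σ i)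

theorem sum_isSmooth {ι : Type*} (s : Finset ι) {T : ι → RawTensorField D M p}
    (hT : ∀ i, (T i).IsSmooth) (c : ι → ℝ) :
    RawTensorField.IsSmooth (D := D) (M := M) (p := p) (fun x => ∑ i ∈ s, c i • T i x) := by
  intro x₀ j
  simp only [_root_.sum_apply, _root_.smul_apply]
  exact contMDiffOn_finsetSum fun i _ => contMDiffOn_const.mul (hT i x₀ j)

theorem youngSymmetrizer_isSmooth (t : Filling p μ) {T : RawTensorField D M p}
    (hT : T.IsSmooth) :
    RawTensorField.IsSmooth (D := D) (M := M) (p := p) (fun x => youngSymmetrizer t (T x)) := by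
  have h1 := sum_isSmooth t.rowPerms (fun σ => permute_isSmooth hT σ) fun _ => 1
  have h2 := sum_isSmooth t.colPerms (fun σ => permute_isSmooth h1 σ)
    fun σ => ((Equiv.Perm.sign σ : ℤ) : ℝ)
  have h3 := sum_isSmooth {()} (fun _ => h2) fun _ => (hookProduct μ : ℝ)⁻¹
  simpa [youngSymmetrizer, LinearMap.sum_apply] using h3

/-- The Young symmetrizer acting pointwise on smooth tensor fields. -/
def youngField (t : Filling p μ) :
    SmoothTensorField D M p →ₗ[ℝ] SmoothTensorField D M p where
  toFun T := ⟨fun x => youngSymmetrizer t (T.1 x), youngSymmetrizer_isSmooth t T.2⟩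
  map_add' S T := Subtype.ext (funext fun x => (youngSymmetrizer t).map_add (S.1 x) (T.1 x))
  map_smul' c T := Subtype.ext (funext fun x => (youngSymmetrizer t).map_smul c (T.1 x))

/-- The module `Ω^p_Y(M)` of smooth covariant tensor fields of degree `p` of the Young symmetry
type given by a filled Young diagram with `p` cells: at every point, the tensor lies in the image
of the Young symmetrizer. -/
def youngTensorField (D : ℕ) (M : Type*) [TopologicalSpace M]
    [ChartedSpace (EuclideanSpace ℝ (Fin D)) M] [IsManifold (𝓡 D) ∞ M] (t : Filling p μ) :
    Submodule C^∞⟮𝓡 D, M; ℝ⟯ (RawTensorField D M p) where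
  carrier := {T | T ∈ SmoothTensorField D M p ∧
    ∀ x, T x ∈ LinearMap.range (youngSymmetrizer (V := TangentSpace (𝓡 D) x) t)}
  add_mem' hS hT := ⟨Submodule.add_mem _ hS.1 hT.1, fun x => Submodule.add_mem _ (hS.2 x) (hT.2 x)⟩
  zero_mem' := ⟨Submodule.zero_mem _, fun _ => Submodule.zero_mem _⟩
  smul_mem' f _ hT := ⟨Submodule.smul_mem _ f hT.1, fun x => Submodule.smul_mem _ (f x) (hT.2 x)⟩

variable {Y : ℕ → YoungDiagram}

/-- The graded module `Ω_Y(M) = ⨁ₚ Ω^p_Y(M)`. -/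
abbrev Omega (D : ℕ) (M : Type*) [TopologicalSpace M]
    [ChartedSpace (EuclideanSpace ℝ (Fin D)) M] [IsManifold (𝓡 D) ∞ M]
    (t : (p : ℕ) → Filling p (Y p)) : Type _ :=
  ⨁ p : ℕ, youngTensorField D M (t p)

variable [T2Space M]
  (cov : CovariantDerivative (𝓡 D) (EuclideanSpace ℝ (Fin D)) (TangentSpace (𝓡 D) : M → Type _))
  [CovariantDerivative.ContMDiffCovariantDerivative cov ∞]

/-- The operator `d_∇ = Y_{p+1} ∘ ∇ : Ω^p_Y(M) → Ω^{p+1}_Y(M)`. -/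
def dNablaDeg (t : (p : ℕ) → Filling p (Y p)) (p : ℕ) :
    youngTensorField D M (t p) →ₗ[ℝ] youngTensorField D M (t (p + 1)) where
  toFun α := ⟨(youngField (t (p + 1)) (nabla cov p ⟨α.1, α.2.1⟩)).1,
    (youngField (t (p + 1)) (nabla cov p ⟨α.1, α.2.1⟩)).2,
    fun x => ⟨(nabla cov p ⟨α.1, α.2.1⟩).1 x, rfl⟩⟩
  map_add' α β := by
    have h := congrArg Subtype.val
      (((youngField (t (p + 1))).comp (nabla cov p)).map_add ⟨α.1, α.2.1⟩ ⟨β.1, β.2.1⟩)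
    exact Subtype.ext h
  map_smul' c α := by
    have h := congrArg Subtype.val
      (((youngField (t (p + 1))).comp (nabla cov p)).map_smul c ⟨α.1, α.2.1⟩)
    exact Subtype.ext h

/-- The operator `d_∇` on the graded module `Ω_Y(M)`. -/
def dNabla (t : (p : ℕ) → Filling p (Y p)) : Module.End ℝ (Omega D M t) :=
  DirectSum.toModule ℝ ℕ (Omega D M t) fun p =>
    (DirectSum.lof ℝ ℕ (fun q => youngTensorField D M (t q)) (p + 1)).comp (dNablaDeg cov t p)

end calculus

end TensorFields

/-! ### Differential operators -/

/-- Linear differential operators of order at most `k` between modules over a commutative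
`ℝ`-algebra `A` (here, `A` is the algebra of smooth functions on a manifold): those of order at
most `0` are the `A`-linear maps, and `L` has order at most `k + 1` if the commutator
`L ∘ a - a ∘ L` has order at most `k` for every `a : A`. -/
def IsDiffOp (A : Type*) [CommRing A] [Algebra ℝ A] {P Q : Type*} [AddCommGroup P] [Module ℝ P]
    [Module A P] [IsScalarTower ℝ A P] [AddCommGroup Q] [Module ℝ Q] [Module A Q]
    [IsScalarTower ℝ A Q] : ℕ → (P →ₗ[ℝ] Q) → Prop
  | 0, L => ∀ (a : A) (x : P), L (a • x) = a • L x
  | k + 1, L => ∀ a : A,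
      IsDiffOp A k (L ∘ₗ Algebra.lsmul ℝ ℝ P a - Algebra.lsmul ℝ ℝ Q a ∘ₗ L)

end YoungCalculus

end

noncomputable section

namespace YoungCalculus

/-! ### Algebra of differential operators -/

namespace IsDiffOp

variable {A : Type*} [CommRing A] [Algebra ℝ A] {P Q R : Type*}
  [AddCommGroup P] [Module ℝ P] [Module A P] [IsScalarTower ℝ A P]
  [AddCommGroup Q] [Module ℝ Q] [Module A Q] [IsScalarTower ℝ A Q]
  [AddCommGroup R] [Module ℝ R] [Module A R] [IsScalarTower ℝ A R]

/-! A Young symmetrizer is a real combination of slot permutations, and `∇` intertwines a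
permutation `σ` of the slots of `T` with the permutation of the slots of `∇T` that fixes the
derivative slot `0` and acts as `σ` on the others (`nabla_permuteField`). All symmetrizers except
the outermost can therefore be moved to the left of the derivatives: on `Ω^p_Y`, `(d_∇)^N = Y_{p+N}
∘ y ∘ ∇^N` with `y` in the span of the permutations (`exists_dNablaIter_eq`).

The `N` derivative slots of `∇^N` are the first `N` slots. The commutator of `∇² - (0 1)∇²` with a
function `f` is multiplication by the antisymmetric part of the Hessian of `f`. It involves no
derivative of the tensor, so this difference has order at most `r = 1`; without torsion the Hessian
is symmetric and `r = 0`. Consequently any transposition of two derivative slots changes `∇^N` by an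
operator of order at most `r + N - 2` (`isDiffOp_nablaIter_sub_swap`).

With fewer than `N` columns, any permutation of the slots sends two of the `N` derivative slots to
one column. Antisymmetrizing that column kills the part symmetric in these two slots, so only the
error of order `r + N - 2` survives (`Filling.isDiffOp_symmetrizer_comp`). Row symmetrization and
the hook normalization enter only as a further combination of permutations and a scalar. -/

variable (A) in
/-- The commutator of a linear map with the multiplication by `a`. -/
def commutator (L : P →ₗ[ℝ] Q) (a : A) : P →ₗ[ℝ] Q :=
  L ∘ₗ Algebra.lsmul ℝ ℝ P a - Algebra.lsmul ℝ ℝ Q a ∘ₗ L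

theorem commutator_apply (L : P →ₗ[ℝ] Q) (a : A) (x : P) :
    commutator A L a x = L (a • x) - a • L x := rfl

theorem zero (k : ℕ) : IsDiffOp A k (0 : P →ₗ[ℝ] Q) := by
  induction k with
  | zero => intro a x; simp
  | succ k ih =>
    intro a
    convert ih using 1
    ext x
    simp

theorem add {k : ℕ} {L K : P →ₗ[ℝ] Q} (hL : IsDiffOp A k L) (hK : IsDiffOp A k K) :
    IsDiffOp A k (L + K) := by
  induction k generalizing L K with
  | zero =>
    intro a x
    simp [hL a x, hK a x]
  | succ k ih =>
    intro a
    convert ih (hL a) (hK a) using 1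
    ext x
    simp
    abel

theorem linear_comp {k : ℕ} {L : P →ₗ[ℝ] Q} {φ : Q →ₗ[ℝ] R} (hφ : IsDiffOp A 0 φ)
    (hL : IsDiffOp A k L) : IsDiffOp A k (φ ∘ₗ L) := by
  induction k generalizing L with
  | zero =>
    intro a x
    simp [hL a x, hφ a]
  | succ k ih =>
    intro a
    convert ih (hL a) using 1
    ext x
    simp [hφ a]

theorem comp_linear {k : ℕ} {L : Q →ₗ[ℝ] R} {φ : P →ₗ[ℝ] Q} (hL : IsDiffOp A k L)
    (hφ : IsDiffOp A 0 φ) : IsDiffOp A k (L ∘ₗ φ) := by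
  induction k generalizing L with
  | zero =>
    intro a x
    simp [hL a, hφ a x]
  | succ k ih =>
    intro a
    convert ih (hL a) using 1
    ext x
    simp [hφ a x]

theorem real_smul {k : ℕ} {L : P →ₗ[ℝ] Q} (c : ℝ) (hL : IsDiffOp A k L) :
    IsDiffOp A k (c • L) := by
  have hc : IsDiffOp A 0 (LinearMap.lsmul ℝ Q c) := fun a x => by
    exact (smul_algebra_smul_comm c a x).symm
  exact linear_comp hc hL

theorem sum {ι : Type*} (s : Finset ι) {k : ℕ} {L : ι → P →ₗ[ℝ] Q}
    (hL : ∀ i ∈ s, IsDiffOp A k (L i)) : IsDiffOp A k (∑ i ∈ s, L i) := by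
  classical
  induction s using Finset.induction_on with
  | empty => simpa using zero k
  | insert i s hi ih =>
    rw [Finset.sum_insert hi]
    exact (hL i (by simp)).add (ih fun j hj => hL j (by simp [hj]))

/-- The commutator is a derivation: `[L ∘ K, a] = L ∘ [K, a] + [L, a] ∘ K`, and in each term one
factor has dropped by one order. The nested induction treats the two terms separately. -/
theorem comp {k l : ℕ} {L : Q →ₗ[ℝ] R} {K : P →ₗ[ℝ] Q} (hL : IsDiffOp A k L)
    (hK : IsDiffOp A l K) : IsDiffOp A (k + l) (L ∘ₗ K) := by
  induction k generalizing l L K with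
  | zero => simpa using linear_comp hL hK
  | succ k ihk =>
    induction l generalizing L K with
    | zero => exact comp_linear hL hK
    | succ l ihl =>
      intro a
      have h := ihk (hL a) hK
      rw [← Nat.add_assoc, Nat.add_right_comm] at h
      have hadd := (ihl hL (hK a)).add h
      have heq : commutator A (L ∘ₗ K) a = L ∘ₗ commutator A K a + commutator A L a ∘ₗ K := by
        ext x
        simp [commutator_apply]
      change IsDiffOp A (k + 1 + l) (commutator A (L ∘ₗ K) a)
      exact heq ▸ hadd

theorem sub_id_comp (k : ℕ) (F : P →ₗ[ℝ] Q) : IsDiffOp A k (F - LinearMap.id ∘ₗ F) := by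
  rw [LinearMap.id_comp, sub_self]
  exact zero k

theorem sub_comp_comp {k : ℕ} {F : P →ₗ[ℝ] Q} {σ τ : Q →ₗ[ℝ] Q} (hσ : IsDiffOp A 0 σ)
    (h₁ : IsDiffOp A k (F - σ ∘ₗ F)) (h₂ : IsDiffOp A k (F - τ ∘ₗ F)) :
    IsDiffOp A k (F - (σ ∘ₗ τ) ∘ₗ F) := by
  have := h₁.add (linear_comp hσ h₂)
  rwa [LinearMap.comp_sub, sub_add_sub_cancel] at this

theorem comp_sub_comp {k l : ℕ} {F : P →ₗ[ℝ] Q} {L : Q →ₗ[ℝ] R} {σ : Q →ₗ[ℝ] Q}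
    {σ' : R →ₗ[ℝ] R} (hL : IsDiffOp A l L) (hσ : L ∘ₗ σ = σ' ∘ₗ L)
    (h : IsDiffOp A k (F - σ ∘ₗ F)) : IsDiffOp A (l + k) (L ∘ₗ F - σ' ∘ₗ L ∘ₗ F) := by
  have := hL.comp h
  rwa [LinearMap.comp_sub, ← LinearMap.comp_assoc, hσ] at this

/-- Differential operators may be recognized after an injective `A`-linear map. -/
theorem of_linear_comp {k : ℕ} {L : P →ₗ[ℝ] Q} {φ : Q →ₗ[ℝ] R} (hφ : IsDiffOp A 0 φ)
    (hinj : Function.Injective φ) (h : IsDiffOp A k (φ ∘ₗ L)) : IsDiffOp A k L := by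
  induction k generalizing L with
  | zero =>
    intro a x
    apply hinj
    rw [hφ a]
    exact h a x
  | succ k ih =>
    intro a
    apply ih
    convert h a using 1
    ext x
    simp [hφ a]

/-- Differential operators on a direct sum may be recognized on the summands. -/
theorem of_directSum {ι : Type*} [DecidableEq ι] {P : ι → Type*} [∀ i, AddCommGroup (P i)]
    [∀ i, Module ℝ (P i)] [∀ i, Module A (P i)] [∀ i, IsScalarTower ℝ A (P i)]
    {k : ℕ} {L : (⨁ i, P i) →ₗ[ℝ] Q}
    (h : ∀ i, IsDiffOp A k (L ∘ₗ DirectSum.lof ℝ ι P i)) : IsDiffOp A k L := by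
  induction k generalizing L with
  | zero =>
    intro a x
    have : L ∘ₗ Algebra.lsmul ℝ ℝ (⨁ i, P i) a = Algebra.lsmul ℝ ℝ Q a ∘ₗ L := by
      refine DirectSum.linearMap_ext ℝ fun i => LinearMap.ext fun y => ?_
      have h1 := h i a y
      simp only [LinearMap.comp_apply, Algebra.lsmul_coe] at h1 ⊢
      rw [← h1]
      congr 1
      -- The injections of a summand over `ℝ` and over `A` are the same function, so `A`-linearity
      -- of the latter applies.
      exact (map_smul (DirectSum.lof A ι P i) a y).symm
    exact LinearMap.congr_fun this x
  | succ k ih =>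
    intro a
    refine ih fun i => ?_
    convert h i a using 1
    ext y
    simp only [LinearMap.sub_apply, LinearMap.comp_apply, Algebra.lsmul_coe]
    congr 2
    exact (map_smul (DirectSum.lof A ι P i) a y).symm

theorem directSum_lof {ι : Type*} [DecidableEq ι] (P : ι → Type*) [∀ i, AddCommGroup (P i)]
    [∀ i, Module ℝ (P i)] [∀ i, Module A (P i)] [∀ i, IsScalarTower ℝ A (P i)] (i : ι) :
    IsDiffOp A 0 (DirectSum.lof ℝ ι P i) :=
  fun a x => map_smul (DirectSum.lof A ι P i) a x

end IsDiffOp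

/-! ### Annihilation of partially symmetric tensors by Young symmetrizers -/

section Symmetrizer

variable {q : ℕ} {μ : YoungDiagram}

/-- A Young diagram is closed upwards, so every column meets row `0`; the length of that row is thus
the number of columns. -/
theorem Filling.col_lt_rowLen (t : Filling q μ) (i : Fin q) : t.col i < μ.rowLen 0 := by
  rw [← YoungDiagram.mem_iff_lt_rowLen]
  exact μ.up_left_mem (Nat.zero_le _) le_rfl (t i).2

theorem Filling.swap_mem_colPerms (t : Filling q μ) {i j : Fin q} (h : t.col i = t.col j) :
    Equiv.swap i j ∈ t.colPerms := by
  simp only [Filling.colPerms, Finset.mem_filter, Finset.mem_univ, true_and]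
  intro k
  by_cases hi : k = i
  · subst hi; simp [h]
  · by_cases hj : k = j
    · subst hj; simp [h]
    · rw [Equiv.swap_apply_of_ne_of_ne hi hj]

theorem Filling.mul_mem_colPerms (t : Filling q μ) {σ τ : Equiv.Perm (Fin q)}
    (hσ : σ ∈ t.colPerms) (hτ : τ ∈ t.colPerms) : σ * τ ∈ t.colPerms := by
  simp only [Filling.colPerms, Finset.mem_filter, Finset.mem_univ, true_and] at *
  exact fun i => (hσ (τ i)).trans (hτ i)

variable {A : Type*} [CommRing A] [Algebra ℝ A] {P Q : Type*}
  [AddCommGroup P] [Module ℝ P] [Module A P] [IsScalarTower ℝ A P]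
  [AddCommGroup Q] [Module ℝ Q] [Module A Q] [IsScalarTower ℝ A Q]
  {S : Equiv.Perm (Fin q) → Q →ₗ[ℝ] Q}

/-- Up to operators of order `k`, the Young symmetrizer of a diagram with fewer than `N` columns
annihilates tensors that are symmetric in `N` slots up to operators of order `k`. -/
theorem Filling.isDiffOp_symmetrizer_comp (t : Filling q μ) {N k : ℕ} (hN : N ≤ q)
    (hμ : μ.rowLen 0 < N) (hS : ∀ σ τ, S (σ * τ) = S σ ∘ₗ S τ) (hS0 : ∀ σ, IsDiffOp A 0 (S σ))
    {F : P →ₗ[ℝ] Q}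
    (hF : ∀ a b : Fin q, a.1 < N → b.1 < N → IsDiffOp A k (F - S (Equiv.swap a b) ∘ₗ F))
    (ρ : Equiv.Perm (Fin q)) :
    IsDiffOp A k
      (∑ c ∈ t.colPerms, ((Equiv.Perm.sign c : ℤ) : ℝ) • (S (c * ρ) ∘ₗ F)) := by
  -- Pigeonhole: `ρ` distributes the first `N` slots among fewer than `N` columns.
  obtain ⟨a, b, hab, hcol⟩ := Fintype.exists_ne_map_eq_of_card_lt
    (fun i : Fin N => (⟨t.col (ρ (Fin.castLE hN i)), t.col_lt_rowLen _⟩ : Fin (μ.rowLen 0)))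
    (by simpa using hμ)
  set a' := Fin.castLE hN a
  set b' := Fin.castLE hN b
  have hab' : ρ a' ≠ ρ b' := fun h => hab (Fin.castLE_injective hN (ρ.injective h))
  have hκ := t.swap_mem_colPerms (Fin.mk.inj_iff.1 hcol : t.col (ρ a') = t.col (ρ b'))
  set κ := Equiv.swap (ρ a') (ρ b')
  have hκρ : ρ * Equiv.swap a' b' = κ * ρ := Equiv.mul_swap_eq_swap_mul ..
  set G := ∑ c ∈ t.colPerms, ((Equiv.Perm.sign c : ℤ) : ℝ) • (S (c * ρ) ∘ₗ F) with hG
  -- Since `ρ (a' b') = κ ρ` with `κ` an odd column permutation, the reindexing `c ↦ c κ` changes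
  -- the sign of the sum.
  have hneg : ∑ c ∈ t.colPerms, ((Equiv.Perm.sign c : ℤ) : ℝ) •
      (S (c * ρ * Equiv.swap a' b') ∘ₗ F) = -G := by
    rw [hG, ← Finset.sum_neg_distrib]
    refine Finset.sum_bij' (fun c _ => c * κ) (fun c _ => c * κ)
      (fun c hc => t.mul_mem_colPerms hc hκ) (fun c hc => t.mul_mem_colPerms hc hκ)
      (fun c _ => by simp [mul_assoc, κ]) (fun c _ => by simp [mul_assoc, κ]) fun c _ => ?_
    rw [mul_assoc, hκρ, ← mul_assoc, Equiv.Perm.sign_mul, Equiv.Perm.sign_swap hab']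
    simp
  -- Hence `G` is half the difference of the two sums, in which `F` occurs only through `F - (a'
  -- b')F`.
  have hGG : G = (2⁻¹ : ℝ) • ∑ c ∈ t.colPerms, ((Equiv.Perm.sign c : ℤ) : ℝ) •
      (S (c * ρ) ∘ₗ (F - S (Equiv.swap a' b') ∘ₗ F)) := by
    simp only [LinearMap.comp_sub, smul_sub, Finset.sum_sub_distrib, ← LinearMap.comp_assoc, ← hS]
    rw [hneg, ← hG]
    module
  rw [hGG]
  exact (IsDiffOp.sum _ fun c _ => (IsDiffOp.linear_comp (hS0 _)
    (hF a' b' a.2 b.2)).real_smul _).real_smul _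

/-- The span of the operators `S σ` is closed under composition. -/
theorem comp_mem_span (hS : ∀ σ τ, S (σ * τ) = S σ ∘ₗ S τ) {x y : Q →ₗ[ℝ] Q}
    (hx : x ∈ Submodule.span ℝ (Set.range S)) (hy : y ∈ Submodule.span ℝ (Set.range S)) :
    x ∘ₗ y ∈ Submodule.span ℝ (Set.range S) := by
  have h : x * y ∈ Submodule.span ℝ (Set.range S) * Submodule.span ℝ (Set.range S) :=
    Submodule.mul_mem_mul hx hy
  rw [Submodule.span_mul_span] at h
  refine Submodule.span_mono ?_ h
  rintro _ ⟨_, ⟨σ, rfl⟩, _, ⟨τ, rfl⟩, rfl⟩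
  exact ⟨σ * τ, hS σ τ⟩

/-- The Young symmetrizer of a diagram with fewer than `N` columns, followed on the right by any
combination of permutations, annihilates tensors that are symmetric in `N` slots, up to operators
of order `k`. -/
theorem Filling.isDiffOp_symmetrizer_comp_span (t : Filling q μ) {N k : ℕ} (hN : N ≤ q)
    (hμ : μ.rowLen 0 < N) (hS : ∀ σ τ, S (σ * τ) = S σ ∘ₗ S τ) (hS0 : ∀ σ, IsDiffOp A 0 (S σ))
    {F : P →ₗ[ℝ] Q}
    (hF : ∀ a b : Fin q, a.1 < N → b.1 < N → IsDiffOp A k (F - S (Equiv.swap a b) ∘ₗ F))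
    {y : Q →ₗ[ℝ] Q} (hy : y ∈ Submodule.span ℝ (Set.range S)) (r : ℝ) :
    IsDiffOp A k ((r • ∑ τ ∈ t.rowPerms, ∑ c ∈ t.colPerms,
      ((Equiv.Perm.sign c : ℤ) : ℝ) • S (c * τ)) ∘ₗ y ∘ₗ F) := by
  induction hy using Submodule.span_induction with
  | mem y hy =>
    obtain ⟨σ, rfl⟩ := hy
    -- Row permutations and the extra permutation are absorbed into `ρ = τ σ`, leaving one column
    -- antisymmetrization for each `τ`.
    have := (IsDiffOp.sum t.rowPerms fun τ _ =>
      t.isDiffOp_symmetrizer_comp hN hμ hS hS0 hF (τ * σ)).real_smul r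
    convert this using 1
    ext x
    simp [LinearMap.sum_apply, ← mul_assoc, hS]
  | zero => simpa using IsDiffOp.zero k
  | add x y _ _ hx hy => simpa only [LinearMap.add_comp, LinearMap.comp_add] using hx.add hy
  | smul c x _ hx => simpa only [LinearMap.smul_comp, LinearMap.comp_smul] using hx.real_smul c

/-- An intertwining relation with permutations extends to their linear combinations. -/
theorem exists_mem_span_comp_eq {q' : ℕ} {R : Type*} [AddCommGroup R] [Module ℝ R]
    {S' : Equiv.Perm (Fin q') → R →ₗ[ℝ] R} {L : Q →ₗ[ℝ] R}
    (h : ∀ σ, ∃ σ', L ∘ₗ S σ = S' σ' ∘ₗ L) {y : Q →ₗ[ℝ] Q}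
    (hy : y ∈ Submodule.span ℝ (Set.range S)) :
    ∃ y' ∈ Submodule.span ℝ (Set.range S'), L ∘ₗ y = y' ∘ₗ L := by
  induction hy using Submodule.span_induction with
  | mem y hy =>
    obtain ⟨σ, rfl⟩ := hy
    obtain ⟨σ', hσ'⟩ := h σ
    exact ⟨S' σ', Submodule.subset_span ⟨σ', rfl⟩, hσ'⟩
  | zero => exact ⟨0, Submodule.zero_mem _, by simp⟩
  | add x y _ _ hx hy =>
    obtain ⟨x', hx', hx⟩ := hx
    obtain ⟨y', hy', hy⟩ := hy
    exact ⟨x' + y', Submodule.add_mem _ hx' hy', by rw [LinearMap.comp_add, hx, hy,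
      LinearMap.add_comp]⟩
  | smul c x _ hx =>
    obtain ⟨x', hx', hx⟩ := hx
    exact ⟨c • x', Submodule.smul_mem _ c hx', by rw [LinearMap.comp_smul, hx,
      LinearMap.smul_comp]⟩

end Symmetrizer

open VectorField in
/-- The Lie bracket of vector fields acts on functions as the commutator of derivations. -/
theorem mvfderiv_mlieBracket {D : ℕ} {M : Type*} [TopologicalSpace M]
    [ChartedSpace (EuclideanSpace ℝ (Fin D)) M] [IsManifold (𝓡 D) ∞ M]
    {f : M → ℝ} (hf : ContMDiff (𝓡 D) 𝓘(ℝ, ℝ) ∞ f) {x : M}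
    {U W : (y : M) → TangentSpace (𝓡 D) y} (hU : DiffAt U x) (hW : DiffAt W x)
    (hfU : MDifferentiableAt (𝓡 D) 𝓘(ℝ, ℝ) (fun y => mvfderiv (𝓡 D) f y (U y)) x)
    (hfW : MDifferentiableAt (𝓡 D) 𝓘(ℝ, ℝ) (fun y => mvfderiv (𝓡 D) f y (W y)) x) :
    mvfderiv (𝓡 D) f x (mlieBracket (𝓡 D) U W x) =
      mvfderiv (𝓡 D) (fun y => mvfderiv (𝓡 D) f y (W y)) x (U x) -
        mvfderiv (𝓡 D) (fun y => mvfderiv (𝓡 D) f y (U y)) x (W x) := by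
  have : IsManifold (𝓡 D) 2 M := IsManifold.of_le (n := ∞) (by norm_cast)
  set φ := extChartAt (𝓡 D) x with hφ
  set pb : ((y : M) → TangentSpace (𝓡 D) y) →
    EuclideanSpace ℝ (Fin D) → EuclideanSpace ℝ (Fin D) :=
    fun V => mpullbackWithin 𝓘(ℝ, EuclideanSpace ℝ (Fin D)) (𝓡 D) φ.symm V Set.univ with hpb
  -- The identity is transported to the chart at `x`: differentiating `h` along `V` is
  -- differentiating its coordinate expression along the pulled back field.
  have hchain : ∀ (h : M → ℝ) (V : (y : M) → TangentSpace (𝓡 D) y) (e : EuclideanSpace ℝ (Fin D)),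
      e ∈ φ.target → MDifferentiableAt (𝓡 D) 𝓘(ℝ, ℝ) h (φ.symm e) →
      fderiv ℝ (h ∘ φ.symm) e (pb V e) = mvfderiv (𝓡 D) h (φ.symm e) (V (φ.symm e)) := by
    intro h V e he hh
    have hi := isInvertible_mfderivWithin_extChartAt_symm (I := 𝓡 D) he
    rw [ModelWithCorners.range_eq_univ] at hi
    have hd : MDifferentiableAt 𝓘(ℝ, EuclideanSpace ℝ (Fin D)) (𝓡 D) φ.symm e := by
      have := mdifferentiableWithinAt_extChartAt_symm (I := 𝓡 D) he
      rwa [ModelWithCorners.range_eq_univ, mdifferentiableWithinAt_univ] at this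
    have h1 := mvfderiv_comp_apply e hh hd (pb V e)
    have h2 : mfderiv 𝓘(ℝ, EuclideanSpace ℝ (Fin D)) (𝓡 D) φ.symm e (pb V e) =
        V (φ.symm e) := by
      have : mfderiv 𝓘(ℝ, EuclideanSpace ℝ (Fin D)) (𝓡 D) φ.symm e =
          mfderivWithin 𝓘(ℝ, EuclideanSpace ℝ (Fin D)) (𝓡 D) φ.symm Set.univ e := by
        simp
      rw [this]
      exact hi.self_apply_inverse _
    rw [h2] at h1
    rw [← h1]
    simp only [mvfderiv, mfderiv_eq_fderiv]
    rfl
  have hx : φ.symm (φ x) = x := extChartAt_to_inv x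
  have hxt : φ x ∈ φ.target := mem_extChartAt_target x
  have hfd : MDifferentiable (𝓡 D) 𝓘(ℝ, ℝ) f := hf.mdifferentiable (by simp)
  have hpbd : ∀ {V : (y : M) → TangentSpace (𝓡 D) y}, DiffAt V x →
      DifferentiableAt ℝ (pb V) (φ x) := by
    intro V hV
    have := MDifferentiableWithinAt.differentiableWithinAt_mpullbackWithin_vectorField
      (s := Set.univ) (mdifferentiableWithinAt_univ.2 hV)
    rw [Set.preimage_univ, Set.univ_inter, ModelWithCorners.range_eq_univ] at this
    exact differentiableWithinAt_univ.1 this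
  have hsec : ∀ {V V' : (y : M) → TangentSpace (𝓡 D) y},
      MDifferentiableAt (𝓡 D) 𝓘(ℝ, ℝ) (fun y => mvfderiv (𝓡 D) f y (V y)) x →
      fderiv ℝ (fun e => fderiv ℝ (f ∘ φ.symm) e (pb V e)) (φ x) (pb V' (φ x)) =
        mvfderiv (𝓡 D) (fun y => mvfderiv (𝓡 D) f y (V y)) x (V' x) := by
    intro V V' hV
    have h1 := hchain (fun y => mvfderiv (𝓡 D) f y (V y)) V' (φ x) hxt (by rwa [hx])
    have h2 : (fun e => fderiv ℝ (f ∘ φ.symm) e (pb V e)) =ᶠ[𝓝 (φ x)]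
        (fun y => mvfderiv (𝓡 D) f y (V y)) ∘ φ.symm := by
      filter_upwards [(isOpen_extChartAt_target x).mem_nhds hxt] with e he
      exact hchain f V e he (hfd _)
    rw [h2.fderiv_eq, h1, hx]
  have hg : ContDiffAt ℝ 2 (f ∘ φ.symm) (φ x) := by
    have h1 := (contMDiffOn_extChartAt_symm (I := 𝓡 D) (n := ∞) x).contMDiffAt
      ((isOpen_extChartAt_target x).mem_nhds hxt)
    exact ((hf.contMDiffAt.comp _ h1).contDiffAt).of_le (by norm_cast)
  -- In the vector space this is the symmetry of the second derivative, which is why `f` is needed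
  -- to be `C²` in the chart.
  have hbr := fderiv_apply_lieBracket hg (by simp) (hpbd hW) (hpbd hU)
  rw [hsec hfW, hsec hfU] at hbr
  have hinv := isInvertible_mfderiv_extChartAt (I := 𝓡 D) (mem_extChartAt_source (I := 𝓡 D) x)
  -- The bracket on the manifold is by definition the pullback of the bracket in the chart, so the
  -- derivative of the chart undoes that pullback.
  have hb : mfderiv (𝓡 D) 𝓘(ℝ, EuclideanSpace ℝ (Fin D)) φ x (mlieBracket (𝓡 D) U W x) =
      lieBracket ℝ (pb U) (pb W) (φ x) := by
    have h1 := mlieBracketWithin_apply (I := 𝓡 D) (s := Set.univ) (x₀ := x) (V := U) (W := W)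
    rw [Set.preimage_univ, Set.univ_inter, ModelWithCorners.range_eq_univ] at h1
    rw [← mlieBracketWithin_univ, h1]
    refine (hinv.self_apply_inverse _).trans ?_
    exact congrFun (lieBracketWithin_univ (𝕜 := ℝ) (V := pb U) (W := pb W)) (φ x)
  have hgm : MDifferentiableAt 𝓘(ℝ, EuclideanSpace ℝ (Fin D)) 𝓘(ℝ, ℝ) (f ∘ φ.symm) (φ x) :=
    (hg.differentiableAt two_ne_zero).mdifferentiableAt
  have hcomp := mvfderiv_comp_apply x hgm
    (mdifferentiableAt_extChartAt (mem_chart_source _ x)) (mlieBracket (𝓡 D) U W x)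
  have hloc : f =ᶠ[𝓝 x] (f ∘ φ.symm) ∘ φ := by
    filter_upwards [extChartAt_source_mem_nhds (I := 𝓡 D) x] with y hy
    simp only [Function.comp]
    rw [φ.left_inv hy]
  rw [← hbr, ← hb]
  have h3 : mvfderiv (𝓡 D) f x = mvfderiv (𝓡 D) ((f ∘ φ.symm) ∘ φ) x := hloc.mfderiv_eq
  rw [h3]
  refine hcomp.trans ?_
  simp only [mvfderiv, mfderiv_eq_fderiv]
  rfl

/-! ### Commutators of the covariant derivative with functions -/

section Covariant

variable {D : ℕ} {M : Type*} [TopologicalSpace M] [ChartedSpace (EuclideanSpace ℝ (Fin D)) M]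
  [IsManifold (𝓡 D) ∞ M] {p : ℕ}

/-- The permutation `σ` of the slots of a smooth tensor field. -/
def permuteField (σ : Equiv.Perm (Fin p)) :
    SmoothTensorField D M p →ₗ[ℝ] SmoothTensorField D M p where
  toFun T := ⟨fun x => permute σ (T.1 x), permute_isSmooth T.2 σ⟩
  map_add' _ _ := rfl
  map_smul' _ _ := rfl

theorem permuteField_apply (σ : Equiv.Perm (Fin p)) (T : SmoothTensorField D M p) (x : M)
    (v : Fin p → TangentSpace (𝓡 D) x) :
    (permuteField σ T).1 x v = T.1 x fun i => v (σ i) := rfl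

/-- Both sides evaluate `T` on `v ∘ σ ∘ τ`, so permutations act from the left without inverses. -/
theorem permuteField_mul (σ τ : Equiv.Perm (Fin p)) :
    (permuteField (σ * τ) : SmoothTensorField D M p →ₗ[ℝ] _) =
      permuteField σ ∘ₗ permuteField τ := rfl

theorem permuteField_one : (permuteField 1 : SmoothTensorField D M p →ₗ[ℝ] _) = LinearMap.id := rfl

theorem isDiffOp_permuteField (σ : Equiv.Perm (Fin p)) :
    IsDiffOp C^∞⟮𝓡 D, M; ℝ⟯ 0 (permuteField σ : SmoothTensorField D M p →ₗ[ℝ] _) :=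
  fun _ _ => rfl

theorem SmoothTensorField.ext {S T : SmoothTensorField D M p}
    (h : ∀ x (v : Fin p → TangentSpace (𝓡 D) x), S.1 x v = T.1 x v) : S = T :=
  Subtype.ext (funext fun x => MultilinearMap.ext (h x))

/-- The tensor field of degree `0` with constant value `1`. -/
def oneField (D : ℕ) (M : Type*) [TopologicalSpace M]
    [ChartedSpace (EuclideanSpace ℝ (Fin D)) M] [IsManifold (𝓡 D) ∞ M] :
    SmoothTensorField D M 0 :=
  ⟨fun _ => MultilinearMap.constOfIsEmpty ℝ _ 1, fun _ _ => contMDiffOn_const⟩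

variable [T2Space M]
  (cov : CovariantDerivative (𝓡 D) (EuclideanSpace ℝ (Fin D)) (TangentSpace (𝓡 D) : M → Type _))
  [CovariantDerivative.ContMDiffCovariantDerivative cov ∞]

/-- The commutator of `∇` with a function `f` is the tensor product with `df`. -/
theorem commutator_nabla_apply (f : C^∞⟮𝓡 D, M; ℝ⟯) (T : SmoothTensorField D M p) (x : M)
    (v : Fin (p + 1) → TangentSpace (𝓡 D) x) :
    (IsDiffOp.commutator _ (nabla cov p) f T).1 x v =
      mvfderiv (𝓡 D) f x (v 0) * T.1 x fun i => v i.succ := by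
  change covAux cov (f • T.1) x _ _ - f x * covAux cov T.1 x _ _ = _
  simp only [covAux, RawTensorField.fsmul_apply, _root_.smul_apply]
  rw [mvfderiv_fun_smul (f.contMDiff.mdifferentiable (by simp) _)
    (mdifferentiableAt_apply T.2 fun _ => FiberBundle.mdifferentiableAt_extend ..)]
  simp [mul_sub, Finset.mul_sum]

/-- Applied to the constant `1`, the commutator `[∇, f]` is `df`; this exhibits `df` as a smooth
tensor field of degree `1`. -/
theorem mdifferentiableAt_mvfderiv_apply
    (cov : CovariantDerivative (𝓡 D) (EuclideanSpace ℝ (Fin D))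
      (TangentSpace (𝓡 D) : M → Type _))
    [CovariantDerivative.ContMDiffCovariantDerivative cov ∞] (f : C^∞⟮𝓡 D, M; ℝ⟯)
    {X : (y : M) → TangentSpace (𝓡 D) y} {x : M} (hX : DiffAt X x) :
    MDifferentiableAt (𝓡 D) 𝓘(ℝ, ℝ) (fun y => mvfderiv (𝓡 D) f y (X y)) x := by
  have h := mdifferentiableAt_apply (IsDiffOp.commutator _ (nabla cov 0) f (oneField D M)).2
    (X := fun _ => X) fun _ => hX
  simp only [commutator_nabla_apply] at h
  simpa [oneField] using h

/-- The second covariant derivative of a function. -/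
def hessian (f : C^∞⟮𝓡 D, M; ℝ⟯) (x : M) (u w : TangentSpace (𝓡 D) x) : ℝ :=
  mvfderiv (𝓡 D) (fun y => mvfderiv (𝓡 D) f y
    (FiberBundle.extend (EuclideanSpace ℝ (Fin D)) w y)) x u -
    mvfderiv (𝓡 D) f x (cov (FiberBundle.extend (EuclideanSpace ℝ (Fin D)) w) x u)

/-- For extensions `U`, `W` of `u`, `w`, the second derivatives of `f` differ by `df([U, W])`, and
vanishing torsion makes the connection terms differ by the same amount. -/
theorem hessian_symm (hcov : cov.torsion = 0) (f : C^∞⟮𝓡 D, M; ℝ⟯) (x : M)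
    (u w : TangentSpace (𝓡 D) x) : hessian cov f x u w = hessian cov f x w u := by
  have hu : DiffAt (FiberBundle.extend (EuclideanSpace ℝ (Fin D)) u) x :=
    FiberBundle.mdifferentiableAt_extend ..
  have hw : DiffAt (FiberBundle.extend (EuclideanSpace ℝ (Fin D)) w) x :=
    FiberBundle.mdifferentiableAt_extend ..
  have h1 := mvfderiv_mlieBracket f.contMDiff hu hw (mdifferentiableAt_mvfderiv_apply cov f hu)
    (mdifferentiableAt_mvfderiv_apply cov f hw)
  have h2 := (cov.torsion_eq_zero_iff.1 hcov) hu hw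
  rw [← h2, map_sub] at h1
  simp only [FiberBundle.extend_apply_self] at h1
  simp only [hessian]
  linarith

/-- Leibniz rule `∇(df ⊗ T) = ∇df ⊗ T + df ⊗ ∇T`; the new derivative takes slot `0`, so `df` sits in
slot `1`. -/
theorem nabla_commutator_nabla_apply (f : C^∞⟮𝓡 D, M; ℝ⟯) (T : SmoothTensorField D M p) (x : M)
    (v : Fin (p + 2) → TangentSpace (𝓡 D) x) :
    (nabla cov (p + 1) (IsDiffOp.commutator _ (nabla cov p) f T)).1 x v =
      hessian cov f x (v 0) (v 1) * T.1 x (fun i => v i.succ.succ) +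
        mvfderiv (𝓡 D) f x (v 1) *
          (nabla cov p T).1 x (Fin.cons (v 0) fun i => v i.succ.succ) := by
  set X : Fin (p + 1) → (y : M) → TangentSpace (𝓡 D) y :=
    fun i => FiberBundle.extend (EuclideanSpace ℝ (Fin D)) (v i.succ) with hX
  have hXd : ∀ i, DiffAt (X i) x := fun i => FiberBundle.mdifferentiableAt_extend ..
  have hXx : ∀ i, X i x = v i.succ := fun i => FiberBundle.extend_apply_self ..
  have h1 := nabla_apply cov (IsDiffOp.commutator _ (nabla cov p) f T) x X hXd (v 0)
  have h2 := nabla_apply cov T x (fun i => X i.succ) (fun i => hXd i.succ) (v 0)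
  simp only [hXx] at h1 h2
  have hv : (Fin.cons (v 0) fun i : Fin (p + 1) => v i.succ : Fin (p + 2) → TangentSpace (𝓡 D) x)
      = v := Fin.cons_self_tail v
  rw [hv] at h1
  rw [h1, h2]
  simp only [commutator_nabla_apply]
  -- Splitting off index `0` of the sum isolates the connection term acting on `df`, which completes
  -- the Hessian; the other terms complete `∇T`.
  rw [mvfderiv_fun_mul (mdifferentiableAt_mvfderiv_apply cov f (hXd 0))
    (mdifferentiableAt_apply T.2 fun i => hXd i.succ), Fin.sum_univ_succ]
  have h0 : ∀ (i : Fin p) (a : TangentSpace (𝓡 D) x),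
      Function.update (fun k : Fin (p + 1) => v k.succ) i.succ a 0 = v 1 := fun i a =>
    Function.update_of_ne (Fin.succ_ne_zero i).symm _ _
  have h3 : ∀ (i : Fin p) (a : TangentSpace (𝓡 D) x),
      (fun k : Fin p => Function.update (fun k : Fin (p + 1) => v k.succ) i.succ a k.succ) =
      Function.update (fun k : Fin p => v k.succ.succ) i a := fun i a => by
    funext k
    by_cases hk : k = i
    · subst hk; simp
    · simp [hk]
  simp only [h0, h3, Function.update_self, ne_eq, Fin.succ_ne_zero, not_false_eq_true,
    Function.update_of_ne, ← Finset.mul_sum, hessian]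
  simp [hX]
  ring

/-- Two covariant derivatives commute up to an operator of order `1`. -/
theorem commutator_nabla_sub_swap_apply (f : C^∞⟮𝓡 D, M; ℝ⟯) (T : SmoothTensorField D M p) (x : M)
    (v : Fin (p + 2) → TangentSpace (𝓡 D) x) :
    (IsDiffOp.commutator _ (nabla cov (p + 1) ∘ₗ nabla cov p -
      permuteField (Equiv.swap 0 1) ∘ₗ nabla cov (p + 1) ∘ₗ nabla cov p) f T).1 x v =
      (hessian cov f x (v 0) (v 1) - hessian cov f x (v 1) (v 0)) *
        T.1 x fun i => v i.succ.succ := by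
  -- Here `[∇², f] = ∇[∇, f] + [∇, f]∇`. The two resulting terms in `df` and `∇T` are exchanged by
  -- swapping slots `0` and `1`, so they cancel in the difference and only the Hessian remains.
  have hsecond : ∀ w : Fin (p + 2) → TangentSpace (𝓡 D) x,
      (IsDiffOp.commutator _ (nabla cov (p + 1) ∘ₗ nabla cov p) f T).1 x w =
        hessian cov f x (w 0) (w 1) * T.1 x (fun i => w i.succ.succ) +
        (mvfderiv (𝓡 D) f x (w 1) *
          (nabla cov p T).1 x (Fin.cons (w 0) fun i => w i.succ.succ) +
        mvfderiv (𝓡 D) f x (w 0) *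
          (nabla cov p T).1 x (Fin.cons (w 1) fun i => w i.succ.succ)) := by
    intro w
    have : IsDiffOp.commutator _ (nabla cov (p + 1) ∘ₗ nabla cov p) f T =
        nabla cov (p + 1) (IsDiffOp.commutator _ (nabla cov p) f T) +
          IsDiffOp.commutator _ (nabla cov (p + 1)) f (nabla cov p T) := by
      simp [IsDiffOp.commutator_apply]
    rw [this]
    have hw : (Fin.cons (w 1) fun i : Fin p => w i.succ.succ : Fin (p + 1) → TangentSpace (𝓡 D) x)
      = fun i => w i.succ := Fin.cons_self_tail fun i : Fin (p + 1) => w i.succ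
    rw [hw, ← add_assoc, ← nabla_commutator_nabla_apply,
      ← commutator_nabla_apply cov f (nabla cov p T)]
    rfl
  have hsw : ∀ i : Fin p, Equiv.swap (0 : Fin (p + 2)) 1 i.succ.succ = i.succ.succ := fun i =>
    Equiv.swap_apply_of_ne_of_ne (Fin.succ_ne_zero _) (by simp [Fin.ext_iff])
  have h := hsecond fun i => v (Equiv.swap 0 1 i)
  simp only [Equiv.swap_apply_left, Equiv.swap_apply_right, hsw] at h
  have h' := hsecond v
  have hsplit : (IsDiffOp.commutator _ (nabla cov (p + 1) ∘ₗ nabla cov p -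
      permuteField (Equiv.swap 0 1) ∘ₗ nabla cov (p + 1) ∘ₗ nabla cov p) f T).1 x v =
      (IsDiffOp.commutator _ (nabla cov (p + 1) ∘ₗ nabla cov p) f T).1 x v -
      (IsDiffOp.commutator _ (nabla cov (p + 1) ∘ₗ nabla cov p) f T).1 x
        fun i => v (Equiv.swap 0 1 i) := by
    rw [← permuteField_apply]
    have : IsDiffOp.commutator _ (nabla cov (p + 1) ∘ₗ nabla cov p -
      permuteField (Equiv.swap 0 1) ∘ₗ nabla cov (p + 1) ∘ₗ nabla cov p) f T =
      IsDiffOp.commutator _ (nabla cov (p + 1) ∘ₗ nabla cov p) f T - permuteField (Equiv.swap 0 1)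
      (IsDiffOp.commutator _ (nabla cov (p + 1) ∘ₗ nabla cov p) f T) := by
      simp only [IsDiffOp.commutator_apply, LinearMap.sub_apply, LinearMap.comp_apply, map_sub,
        isDiffOp_permuteField _ f _]
      module
    rw [this]
    rfl
  rw [hsplit, h, h']
  ring

/-- Tensoring with `df` is linear over the smooth functions. -/
theorem isDiffOp_nabla (p : ℕ) : IsDiffOp C^∞⟮𝓡 D, M; ℝ⟯ 1 (nabla cov p) := by
  intro f g T
  change IsDiffOp.commutator _ (nabla cov p) f (g • T) =
    g • IsDiffOp.commutator _ (nabla cov p) f T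
  refine SmoothTensorField.ext fun x v => ?_
  rw [commutator_nabla_apply]
  change _ = g x * (IsDiffOp.commutator _ (nabla cov p) f T).1 x v
  rw [commutator_nabla_apply]
  change _ * (g x * _) = _
  ring

/-- Each derivative alone has order one, but the commutator with `f` only multiplies `T` by the
antisymmetrized Hessian, so one order is gained over the naive bound `2`. -/
theorem isDiffOp_nabla_sub_swap (p : ℕ) :
    IsDiffOp C^∞⟮𝓡 D, M; ℝ⟯ 1 (nabla cov (p + 1) ∘ₗ nabla cov p -
      permuteField (Equiv.swap 0 1) ∘ₗ nabla cov (p + 1) ∘ₗ nabla cov p) := by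
  intro f g T
  refine SmoothTensorField.ext fun x v => ?_
  refine (commutator_nabla_sub_swap_apply cov f (g • T) x v).trans ?_
  refine Eq.trans ?_ (congrArg (g x * ·) (commutator_nabla_sub_swap_apply cov f T x v).symm)
  change _ * (g x * _) = g x * (_ * _)
  ring

/-- For a torsion-free connection, two covariant derivatives commute up to an operator of
order `0`. -/
theorem isDiffOp_nabla_sub_swap_of_torsion_eq_zero (hcov : cov.torsion = 0) (p : ℕ) :
    IsDiffOp C^∞⟮𝓡 D, M; ℝ⟯ 0 (nabla cov (p + 1) ∘ₗ nabla cov p -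
      permuteField (Equiv.swap 0 1) ∘ₗ nabla cov (p + 1) ∘ₗ nabla cov p) := by
  intro f T
  rw [← sub_eq_zero, ← IsDiffOp.commutator_apply]
  refine SmoothTensorField.ext fun x v => ?_
  rw [commutator_nabla_sub_swap_apply, hessian_symm cov hcov, sub_self, zero_mul]
  rfl

end Covariant

/-! ### Symmetry of iterated covariant derivatives up to lower order -/

section Iterates

variable {D : ℕ} {M : Type*} [TopologicalSpace M] [ChartedSpace (EuclideanSpace ℝ (Fin D)) M]
  [IsManifold (𝓡 D) ∞ M] {p : ℕ} [T2Space M]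
  (cov : CovariantDerivative (𝓡 D) (EuclideanSpace ℝ (Fin D)) (TangentSpace (𝓡 D) : M → Type _))
  [CovariantDerivative.ContMDiffCovariantDerivative cov ∞]

/-- The permutation of `Fin (n + 1)` that fixes `0` and acts as `σ` on the successors. -/
def shiftPerm {n : ℕ} (σ : Equiv.Perm (Fin n)) : Equiv.Perm (Fin (n + 1)) :=
  Equiv.Perm.decomposeFin.symm (0, σ)

theorem shiftPerm_zero {n : ℕ} (σ : Equiv.Perm (Fin n)) : shiftPerm σ 0 = 0 := by
  simp [shiftPerm]

theorem shiftPerm_succ {n : ℕ} (σ : Equiv.Perm (Fin n)) (i : Fin n) :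
    shiftPerm σ i.succ = (σ i).succ := by
  simp [shiftPerm]

theorem shiftPerm_swap {n : ℕ} (a b : Fin n) :
    shiftPerm (Equiv.swap a b) = Equiv.swap a.succ b.succ := by
  ext i
  refine Fin.cases ?_ (fun i => ?_) i
  · rw [shiftPerm_zero, Equiv.swap_apply_of_ne_of_ne (Fin.succ_ne_zero a).symm
      (Fin.succ_ne_zero b).symm]
  · rw [shiftPerm_succ, (Fin.succ_injective n).map_swap]

/-- The derivative occupies a new slot in front, and permuting the slots of `T` only relabels the
vector fields being differentiated. -/
theorem nabla_permuteField (σ : Equiv.Perm (Fin p)) :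
    nabla cov p ∘ₗ permuteField σ = permuteField (shiftPerm σ) ∘ₗ nabla cov p := by
  refine LinearMap.ext fun T => SmoothTensorField.ext fun x v => ?_
  change covAux cov (permuteField σ T).1 x _ _ = covAux cov T.1 x _ _
  simp only [covAux, permuteField_apply, shiftPerm_zero, shiftPerm_succ]
  congr 1
  refine (Equiv.sum_comp σ _).symm.trans (Finset.sum_congr rfl fun i _ => ?_)
  congr 1
  exact Function.update_comp_eq_of_injective _ σ.injective _ _

/-- The iterated covariant derivative. -/
def nablaIter (p : ℕ) : (N : ℕ) → SmoothTensorField D M p →ₗ[ℝ] SmoothTensorField D M (p + N)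
  | 0 => LinearMap.id
  | N + 1 => nabla cov (p + N) ∘ₗ nablaIter p N

theorem isDiffOp_nablaIter (p N : ℕ) : IsDiffOp C^∞⟮𝓡 D, M; ℝ⟯ N (nablaIter cov p N) := by
  induction N with
  | zero => exact fun _ _ => rfl
  | succ N ih =>
    have := (isDiffOp_nabla cov (p + N)).comp ih
    rwa [Nat.add_comm 1 N] at this

variable {cov}

/-- If two covariant derivatives commute up to an operator of order `r`, then transposing two of
the slots of derivation changes the iterated covariant derivative of order `n + 2` by an operator
of order `r + n`. -/
theorem isDiffOp_nablaIter_sub_swap {r : ℕ}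
    (h : ∀ p, IsDiffOp C^∞⟮𝓡 D, M; ℝ⟯ r (nabla cov (p + 1) ∘ₗ nabla cov p -
      permuteField (Equiv.swap 0 1) ∘ₗ nabla cov (p + 1) ∘ₗ nabla cov p)) (p n : ℕ)
    (a b : Fin (p + (n + 2))) (ha : a.1 < n + 2) (hb : b.1 < n + 2) :
    IsDiffOp C^∞⟮𝓡 D, M; ℝ⟯ (r + n) (nablaIter cov p (n + 2) -
      permuteField (Equiv.swap a b) ∘ₗ nablaIter cov p (n + 2)) := by
  have hself : ∀ (n : ℕ) (a : Fin (p + (n + 2))),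
      IsDiffOp C^∞⟮𝓡 D, M; ℝ⟯ (r + n) (nablaIter cov p (n + 2) -
        permuteField (Equiv.swap a a) ∘ₗ nablaIter cov p (n + 2)) := by
    intro n a
    rw [Equiv.swap_self]
    exact IsDiffOp.sub_id_comp _ _
  induction n with
  | zero =>
    have h01 : ∀ a : Fin (p + (0 + 2)), a.1 < 0 + 2 →
        a = (0 : Fin (p + 2)) ∨ a = (1 : Fin (p + 2)) := by
      intro a ha
      have : a.1 = 0 ∨ a.1 = 1 := by omega
      refine this.imp (fun h => Fin.ext (by simpa using h)) fun h => Fin.ext (by simpa using h)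
    rcases h01 a ha with rfl | rfl <;> rcases h01 b hb with rfl | rfl
    · exact hself _ _
    · exact h p
    · rw [Equiv.swap_comm]
      exact h p
    · exact hself _ _
  | succ n ih =>
    -- A further `∇` on the left shifts all slots by one and raises the order of the error by one.
    have hsucc : ∀ a b : Fin (p + (n + 2)), a.1 < n + 2 → b.1 < n + 2 →
        IsDiffOp C^∞⟮𝓡 D, M; ℝ⟯ (r + (n + 1)) (nablaIter cov p (n + 1 + 2) -
          permuteField (Equiv.swap a.succ b.succ) ∘ₗ nablaIter cov p (n + 1 + 2)) := by
      intro a b ha hb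
      have := (isDiffOp_nabla cov (p + (n + 2))).comp_sub_comp (nabla_permuteField cov _)
        (ih a b ha hb)
      rwa [shiftPerm_swap, Nat.add_comm 1] at this
    -- The two outermost derivatives are exchanged by the hypothesis, applied after `∇^(n+1)`.
    have hbase : IsDiffOp C^∞⟮𝓡 D, M; ℝ⟯ (r + (n + 1)) (nablaIter cov p (n + 1 + 2) -
        permuteField (Equiv.swap (0 : Fin (p + (n + 1) + 2)) 1) ∘ₗ nablaIter cov p (n + 1 + 2)) :=
      (h (p + (n + 1))).comp (isDiffOp_nablaIter cov p (n + 1))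
    have hzero : ∀ b : Fin (p + (n + 2)), b.1 < n + 2 →
        IsDiffOp C^∞⟮𝓡 D, M; ℝ⟯ (r + (n + 1)) (nablaIter cov p (n + 1 + 2) -
          permuteField (Equiv.swap (0 : Fin (p + (n + 2) + 1)) b.succ) ∘ₗ
            nablaIter cov p (n + 1 + 2)) := by
      intro b hb
      rcases eq_or_ne b (0 : Fin (p + (n + 1) + 1)) with rfl | hb0
      · exact hbase
      · have hs := hsucc (0 : Fin (p + (n + 1) + 1)) b (by simp) hb
        have hne : (0 : Fin (p + (n + 1) + 1)).succ ≠ b.succ :=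
          fun h => hb0 (Fin.succ_injective _ h).symm
        -- Conjugation: `(0 b+1) = (1 0)(b+1 1)(1 0)`, where `(1 0)` is covered by `hbase` and `(b+1
        -- 1)` by `hsucc`.
        have heq := Equiv.swap_mul_swap_mul_swap (x := b.succ)
          (y := (0 : Fin (p + (n + 1) + 1)).succ) (z := (0 : Fin (p + (n + 2) + 1))) hne.symm
          (Fin.succ_ne_zero _)
        rw [← heq, permuteField_mul, permuteField_mul]
        have hb' := Equiv.swap_comm (0 : Fin (p + (n + 2) + 1)) (0 : Fin (p + (n + 1) + 1)).succ ▸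
          hbase
        have hs' := Equiv.swap_comm (0 : Fin (p + (n + 1) + 1)).succ b.succ ▸ hs
        exact ((isDiffOp_permuteField _).comp (isDiffOp_permuteField _)).sub_comp_comp
          ((isDiffOp_permuteField _).sub_comp_comp hb' hs') hb'
    revert ha hb
    refine Fin.cases ?_ (fun a => ?_) a <;> refine Fin.cases ?_ (fun b => ?_) b <;> intro ha hb
    · exact hself _ _
    · exact hzero b (by simpa using hb)
    · rw [Equiv.swap_comm]
      exact hzero a (by simpa using ha)
    · exact hsucc a b (by simpa using ha) (by simpa using hb)

end Iterates


/-! ### Powers of `d_∇` -/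

section Powers

variable {D : ℕ} {M : Type*} [TopologicalSpace M] [ChartedSpace (EuclideanSpace ℝ (Fin D)) M]
  [IsManifold (𝓡 D) ∞ M] {Y : ℕ → YoungDiagram}

/-- The row sum is placed outside so that each inner sum is a column antisymmetrization following
one fixed permutation. -/
theorem youngField_eq {q : ℕ} {μ : YoungDiagram} (t : Filling q μ) :
    (youngField t : SmoothTensorField D M q →ₗ[ℝ] SmoothTensorField D M q) =
      (hookProduct μ : ℝ)⁻¹ • ∑ τ ∈ t.rowPerms, ∑ σ ∈ t.colPerms,
        ((Equiv.Perm.sign σ : ℤ) : ℝ) • permuteField (D := D) (M := M) (σ * τ) := by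
  refine LinearMap.ext fun T => SmoothTensorField.ext fun x v => ?_
  let ev : SmoothTensorField D M q →ₗ[ℝ] ℝ :=
    { toFun := fun S => S.1 x v, map_add' := fun _ _ => rfl, map_smul' := fun _ _ => rfl }
  change youngSymmetrizer t (T.1 x) v = ev (((hookProduct μ : ℝ)⁻¹ • ∑ τ ∈ t.rowPerms,
    ∑ σ ∈ t.colPerms, ((Equiv.Perm.sign σ : ℤ) : ℝ) •
      permuteField (D := D) (M := M) (σ * τ)) T)
  have hev : ∀ σ, ev (permuteField σ T) = T.1 x fun i => v (σ i) := fun _ => rfl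
  simp only [LinearMap.smul_apply, LinearMap.sum_apply, map_sum, map_smul, hev]
  simp only [youngSymmetrizer, LinearMap.smul_apply, LinearMap.comp_apply, LinearMap.sum_apply,
    _root_.smul_apply, _root_.sum_apply, permute_apply, smul_eq_mul, map_sum]
  rfl

theorem youngField_mem_span {q : ℕ} {μ : YoungDiagram} (t : Filling q μ) :
    (youngField t : SmoothTensorField D M q →ₗ[ℝ] SmoothTensorField D M q) ∈
      Submodule.span ℝ (Set.range (permuteField (D := D) (M := M) (p := q))) := by
  rw [youngField_eq]
  exact Submodule.smul_mem _ _ (Submodule.sum_mem _ fun τ _ => Submodule.sum_mem _ fun σ _ =>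
    Submodule.smul_mem _ _ (Submodule.subset_span ⟨σ * τ, rfl⟩))

/-- The inclusion of the tensor fields of given Young symmetry type. -/
def youngInclusion (t : (p : ℕ) → Filling p (Y p)) (p : ℕ) :
    youngTensorField D M (t p) →ₗ[ℝ] SmoothTensorField D M p where
  toFun α := ⟨α.1, α.2.1⟩
  map_add' _ _ := rfl
  map_smul' _ _ := rfl

/-- Slot permutations need not preserve the symmetry type, so orders are computed among all tensor
fields; injectivity brings the bound back. -/
theorem youngInclusion_injective (t : (p : ℕ) → Filling p (Y p)) (p : ℕ) :
    Function.Injective (youngInclusion (D := D) (M := M) t p) := fun _ _ h =>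
  Subtype.ext (congrArg (fun S : SmoothTensorField D M p => S.1) h)

theorem isDiffOp_youngInclusion (t : (p : ℕ) → Filling p (Y p)) (p : ℕ) :
    IsDiffOp C^∞⟮𝓡 D, M; ℝ⟯ 0 (youngInclusion (D := D) (M := M) t p) := fun _ _ => rfl

variable [T2Space M]
  (cov : CovariantDerivative (𝓡 D) (EuclideanSpace ℝ (Fin D)) (TangentSpace (𝓡 D) : M → Type _))
  [CovariantDerivative.ContMDiffCovariantDerivative cov ∞] (t : (p : ℕ) → Filling p (Y p))

/-- The iterates of `d_∇` in a given degree. -/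
def dNablaIter (p : ℕ) :
    (N : ℕ) → youngTensorField D M (t p) →ₗ[ℝ] youngTensorField D M (t (p + N))
  | 0 => LinearMap.id
  | N + 1 => dNablaDeg cov t (p + N) ∘ₗ dNablaIter p N

theorem dNabla_pow_comp_lof (p N : ℕ) :
    (dNabla cov t ^ N) ∘ₗ DirectSum.lof ℝ ℕ (fun q => youngTensorField D M (t q)) p =
      DirectSum.lof ℝ ℕ (fun q => youngTensorField D M (t q)) (p + N) ∘ₗ dNablaIter cov t p N := by
  induction N with
  | zero => rfl
  | succ N ih =>
    refine LinearMap.ext fun α => ?_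
    have h := LinearMap.congr_fun ih α
    simp only [LinearMap.comp_apply] at h ⊢
    rw [pow_succ', Module.End.mul_apply, h]
    exact DirectSum.toModule_lof ..

/-- Each new `∇` is moved past the combination `y` already accumulated, at the cost of shifting its
permutations; the next symmetrizer then joins the combination. -/
theorem exists_dNablaIter_eq (p N : ℕ) :
    ∃ y ∈ Submodule.span ℝ (Set.range (permuteField (D := D) (M := M) (p := p + N))),
      youngInclusion t (p + N) ∘ₗ dNablaIter cov t p N =
        y ∘ₗ nablaIter cov p N ∘ₗ youngInclusion t p := by
  induction N with
  | zero => exact ⟨LinearMap.id, Submodule.subset_span ⟨1, permuteField_one⟩, rfl⟩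
  | succ N ih =>
    obtain ⟨y, hy, h⟩ := ih
    obtain ⟨y', hy', h'⟩ := exists_mem_span_comp_eq
      (fun σ => ⟨shiftPerm σ, nabla_permuteField cov σ⟩) hy
    refine ⟨youngField (t (p + N + 1)) ∘ₗ y',
      comp_mem_span permuteField_mul (youngField_mem_span _) hy', ?_⟩
    calc youngInclusion t (p + N + 1) ∘ₗ dNablaDeg cov t (p + N) ∘ₗ dNablaIter cov t p N
        = youngField (t (p + N + 1)) ∘ₗ nabla cov (p + N) ∘ₗ
            youngInclusion t (p + N) ∘ₗ dNablaIter cov t p N := rfl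
      _ = youngField (t (p + N + 1)) ∘ₗ (nabla cov (p + N) ∘ₗ y) ∘ₗ
            nablaIter cov p N ∘ₗ youngInclusion t p := by rw [h]; rfl
      _ = _ := by rw [h']; rfl

variable {cov t}

/-- If two covariant derivatives commute up to an operator of order `r` and the diagrams have
fewer than `n + 2` columns, then `d_∇ ^ (n + 2)` has order at most `r + n`. -/
theorem isDiffOp_dNabla_pow {r : ℕ}
    (h : ∀ p, IsDiffOp C^∞⟮𝓡 D, M; ℝ⟯ r (nabla cov (p + 1) ∘ₗ nabla cov p -
      permuteField (Equiv.swap 0 1) ∘ₗ nabla cov (p + 1) ∘ₗ nabla cov p)) (n : ℕ)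
    (hY : ∀ p, (Y p).rowLen 0 < n + 2) :
    IsDiffOp C^∞⟮𝓡 D, M; ℝ⟯ (P := Omega D M t) (Q := Omega D M t) (r + n)
      (dNabla cov t ^ (n + 2)) := by
  refine IsDiffOp.of_directSum fun p => ?_
  rw [dNabla_pow_comp_lof]
  refine IsDiffOp.linear_comp (IsDiffOp.directSum_lof _ _) ?_
  refine IsDiffOp.of_linear_comp (isDiffOp_youngInclusion t _) (youngInclusion_injective t _) ?_
  -- Only the first `n + 1` of the `n + 2` factors are absorbed into `y`: the outermost symmetrizer
  -- must stay explicit for its column antisymmetrization to act.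
  obtain ⟨y, hy, hd⟩ := exists_dNablaIter_eq cov t p (n + 1)
  obtain ⟨y', hy', h'⟩ := exists_mem_span_comp_eq
    (fun σ => ⟨shiftPerm σ, nabla_permuteField cov σ⟩) hy
  have heq : youngInclusion t (p + (n + 2)) ∘ₗ dNablaIter cov t p (n + 2) =
      (youngField (t (p + (n + 2))) ∘ₗ y' ∘ₗ nablaIter cov p (n + 2)) ∘ₗ youngInclusion t p := by
    calc _ = youngField (t (p + (n + 2))) ∘ₗ nabla cov (p + (n + 1)) ∘ₗ
            youngInclusion t (p + (n + 1)) ∘ₗ dNablaIter cov t p (n + 1) := rfl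
      _ = youngField (t (p + (n + 2))) ∘ₗ (nabla cov (p + (n + 1)) ∘ₗ y) ∘ₗ
            nablaIter cov p (n + 1) ∘ₗ youngInclusion t p := by rw [hd]; rfl
      _ = _ := by rw [h']; rfl
  rw [heq]
  refine IsDiffOp.comp_linear ?_ (isDiffOp_youngInclusion t p)
  rw [youngField_eq]
  exact (t (p + (n + 2))).isDiffOp_symmetrizer_comp_span (Nat.le_add_left _ _) (hY _)
    permuteField_mul isDiffOp_permuteField (isDiffOp_nablaIter_sub_swap h p n) hy' _

end Powers

end YoungCalculus

end

theorem mainTheorem4 {D : ℕ} {M : Type*} [TopologicalSpace M] [T2Space M]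
    [ChartedSpace (EuclideanSpace ℝ (Fin D)) M] [IsManifold (𝓡 D) ∞ M]
    (cov : CovariantDerivative (𝓡 D) (EuclideanSpace ℝ (Fin D))
      (TangentSpace (𝓡 D) : M → Type _))
    [CovariantDerivative.ContMDiffCovariantDerivative cov ∞]
    (N : ℕ) (hN : 2 ≤ N) (Y : ℕ → YoungDiagram)
    (t : (p : ℕ) → YoungCalculus.Filling p (Y p)) (hY : ∀ p, (Y p).rowLen 0 < N) :
    YoungCalculus.IsDiffOp C^∞⟮𝓡 D, M; ℝ⟯ (P := YoungCalculus.Omega D M t)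
        (Q := YoungCalculus.Omega D M t) (N - 1) (YoungCalculus.dNabla cov t ^ N) ∧
      (cov.torsion = 0 →
        YoungCalculus.IsDiffOp C^∞⟮𝓡 D, M; ℝ⟯ (P := YoungCalculus.Omega D M t)
          (Q := YoungCalculus.Omega D M t) (N - 2) (YoungCalculus.dNabla cov t ^ N)) := by
  obtain ⟨n, rfl⟩ := Nat.exists_eq_add_of_le' hN
  refine ⟨?_, fun hcov => ?_⟩
  -- The two bounds are `r + n` with `N = n + 2`: `r = 1` for any connection and `r = 0` without
  -- torsion.
  · rw [show n + 2 - 1 = 1 + n by omega]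
    exact YoungCalculus.isDiffOp_dNabla_pow (YoungCalculus.isDiffOp_nabla_sub_swap cov) n hY
  · rw [show n + 2 - 2 = 0 + n by omega]
    exact YoungCalculus.isDiffOp_dNabla_pow
      (YoungCalculus.isDiffOp_nabla_sub_swap_of_torsion_eq_zero cov hcov) n hY
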